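/- All Hilbert spaces are finite-dimensional, $\mathcal S(H)$ is the set of density operators on $H$, and logarithms are natural with $\log 0=-\infty$. **Non-signaling error probability.** Let $\mathcal V_{A_o\to B_i}$ be a quantum channel (a completely positive trace-preserving map) and $M\ge 1$ an integer. A non-signaling code for $M$ messages is a bipartite channel from $A_iB_i$ to $A_oB_o$, with $A_i,B_o$ of dimension $M$, whose Choi matrix $J_{A_iA_oB_iB_o}\succcurlyeq 0$ satisfies $J_{A_iB_i}=\mathbb 1$ and, for some matrices $K_{B_iB_o}$ and $L_{A_iA_o}$, $$J_{A_iB_iB_o}=\mathbb 1_{A_i}\otimes K_{B_iB_o},\qquad J_{A_iA_oB_i}=L_{A_iA_o}\otimes \mathbb 1_{B_i}$$ (omitted systems are traced out). Connecting $A_o$ to $B_i$ through $\mathcal V$ gives the effective channel $\Pi(\mathcal V)_{A_i\to B_o}$, and $$1-\varepsilon^{\rm NS}(M,\mathcal V):=\sup_{\Pi}\frac1M\sum_{m=1}^M\langle m|\,\Pi(\mathcal V)(|m\rangle\langle m|)\,|m\rangle ,$$ where the supremum is over all non-signaling codes. **Activated exponent.** With the perfect one-bit channel $\mathcal I_2(X)=\sum_{i=1}^2\langle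 i|X|i\rangle\,|i\rangle\langle i|$, let $$E^{\rm ANS}(r):=\liminf_{n\to\infty}-\frac1n\log\varepsilon^{\rm NS}\big(\lceil e^{nr}\rceil,\ \mathcal W^{\otimes n}\otimes\mathcal I_2\big)\in[0,+\infty].$$ **Petz–Rényi divergence.** For positive semidefinite $\rho,\sigma$ and $\alpha\in(0,1)$, $D_\alpha(\rho\|\sigma):=\frac1{\alpha-1}\log\operatorname{Tr}[\rho^\alpha\sigma^{1-\alpha}]$ (which is $+\infty$ if the trace vanishes), and $D_1(\rho\|\sigma):=\operatorname{Tr}[\rho(\log\rho-\log\sigma)]$ if the support of $\rho$ is contained in that of $\sigma$, and $+\infty$ otherwise. **Proposition.** Let $\mathcal W_{A\to B}$ be a quantum channel with Choi matrix $(J_{\mathcal W})_{RB}=\sum_{i,j}|i\rangle\langle j|_R\otimes\mathcal W(|i\rangle\langle j|_A)$, $R\equiv A$, and let $r\ge 0$ and $\alpha\in(0,1]$. Then $$E^{\rm ANS}(r)\ \ge\ \sup_{\rho_R\in\mathcal S(R)}\ \inf_{\sigma_B\in\mathcal S(B)}\ \frac{1-\alpha}{\alpha}\Big(D_\alpha\big(\sqrt{\rho_R}\,(J_{\mathcal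 W})_{RB}\sqrt{\rho_R}\ \big\|\ \rho_R\otimes\sigma_B\big)-r\Big),$$ with the convention $0\cdot(+\infty)=0$ for $\alpha=1$. -/

import Mathlib

open Matrix Filter
open scoped ComplexOrder Kronecker

noncomputable section

namespace QExp

/-! Operators on a finite-dimensional Hilbert space with orthonormal basis indexed by `a` are
complex matrices `Matrix a a ℂ`; the space of a composite system is indexed by the product type. -/

/-- Density operators (quantum states). -/
structure IsState {a : Type*} [Fintype a] (ρ : Matrix a a ℂ) : Prop where
  posSemidef : ρ.PosSemidef
  trace_eq_one : ρ.trace = 1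

/-- The map `id_k ⊗ W`, applying `W` to every block of a block matrix. -/
def ampliate {a b : Type*} (k : ℕ) (W : Matrix a a ℂ →ₗ[ℂ] Matrix b b ℂ)
    (X : Matrix (Fin k × a) (Fin k × a) ℂ) : Matrix (Fin k × b) (Fin k × b) ℂ :=
  Matrix.of fun p q => W (Matrix.of fun i j => X (p.1, i) (q.1, j)) p.2 q.2

/-- Quantum channels: completely positive and trace-preserving linear maps. -/
structure IsChannel {a b : Type*} [Fintype a] [Fintype b]
    (W : Matrix a a ℂ →ₗ[ℂ] Matrix b b ℂ) : Prop where
  completelyPositive : ∀ (k : ℕ) (X : Matrix (Fin k × a) (Fin k × a) ℂ),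
    X.PosSemidef → (ampliate k W X).PosSemidef
  tracePreserving : ∀ X : Matrix a a ℂ, (W X).trace = X.trace

/-- The Choi matrix `∑ i j, |i⟩⟨j|_R ⊗ W(|i⟩⟨j|)`, with `R ≡ A`. -/
def choi {a b : Type*} [DecidableEq a] (W : Matrix a a ℂ →ₗ[ℂ] Matrix b b ℂ) :
    Matrix (a × b) (a × b) ℂ :=
  Matrix.of fun p q => W (Matrix.single p.1 q.1 1) p.2 q.2

/-- The linear map with a given Choi matrix `J`: `X ↦ ∑ i j, X i j • J_{ij}`, where `J_{ij}` is
the `(i, j)` block of `J`. -/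
def ofChoi {a b : Type*} [Fintype a] (J : Matrix (a × b) (a × b) ℂ) :
    Matrix a a ℂ →ₗ[ℂ] Matrix b b ℂ where
  toFun X := Matrix.of fun k l => ∑ i, ∑ j, X i j * J (i, k) (j, l)
  map_add' X Y := by
    ext k l
    simp [add_mul, Finset.sum_add_distrib]
  map_smul' c X := by
    ext k l
    simp [Finset.mul_sum, mul_assoc]

/-- The tensor product `V ⊗ W` of two maps: the linear map whose Choi matrix is (up to ordering
the tensor factors) the tensor product of the Choi matrices. -/
def tensor {a b a' b' : Type*} [Fintype a] [DecidableEq a] [Fintype a'] [DecidableEq a']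
    (V : Matrix a a ℂ →ₗ[ℂ] Matrix b b ℂ) (W : Matrix a' a' ℂ →ₗ[ℂ] Matrix b' b' ℂ) :
    Matrix (a × a') (a × a') ℂ →ₗ[ℂ] Matrix (b × b') (b × b') ℂ :=
  ofChoi (Matrix.of fun p q =>
    choi V (p.1.1, p.2.1) (q.1.1, q.2.1) * choi W (p.1.2, p.2.2) (q.1.2, q.2.2))

/-- The `n`-fold tensor power `W^{⊗ n}`; the space of `n` systems is indexed by `Fin n → a`. -/
def tensorPow {a b : Type*} [Fintype a] [DecidableEq a] (n : ℕ)
    (W : Matrix a a ℂ →ₗ[ℂ] Matrix b b ℂ) :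
    Matrix (Fin n → a) (Fin n → a) ℂ →ₗ[ℂ] Matrix (Fin n → b) (Fin n → b) ℂ :=
  ofChoi (Matrix.of fun p q => ∏ t, choi W (p.1 t, p.2 t) (q.1 t, q.2 t))

/-- The perfect one-bit classical channel `X ↦ ∑ i, ⟨i|X|i⟩ |i⟩⟨i|`. -/
def bitChannel : Matrix (Fin 2) (Fin 2) ℂ →ₗ[ℂ] Matrix (Fin 2) (Fin 2) ℂ where
  toFun X := Matrix.diagonal X.diag
  map_add' X Y := by
    ext i j
    by_cases h : i = j <;> simp [Matrix.diagonal, h]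
  map_smul' c X := by
    ext i j
    by_cases h : i = j <;> simp [Matrix.diagonal, h]

/-- `J` is the Choi matrix on `A_i A_o B_i B_o` of a non-signaling bipartite channel from
`A_i B_i` (inputs of Alice and Bob) to `A_o B_o` (their outputs). -/
structure IsNonSignaling {ai ao bi bo : Type*} [Fintype ai] [DecidableEq ai] [Fintype ao]
    [Fintype bi] [DecidableEq bi] [Fintype bo]
    (J : Matrix (ai × ao × bi × bo) (ai × ao × bi × bo) ℂ) : Prop where
  /-- complete positivity -/
  posSemidef : J.PosSemidef
  /-- trace preservation: `J_{A_i B_i} = 1` -/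
  tracePreserving : ∀ x x' k k',
    ∑ i, ∑ p, J (x, i, k, p) (x', i, k', p) =
      (1 : Matrix ai ai ℂ) x x' * (1 : Matrix bi bi ℂ) k k'
  /-- no signaling from Alice to Bob: `J_{A_i B_i B_o} = 1_{A_i} ⊗ K_{B_i B_o}` -/
  not_alice_to_bob : ∃ K : Matrix (bi × bo) (bi × bo) ℂ, ∀ x x' k k' p p',
    ∑ i, J (x, i, k, p) (x', i, k', p') = (1 : Matrix ai ai ℂ) x x' * K (k, p) (k', p')
  /-- no signaling from Bob to Alice: `J_{A_i A_o B_i} = L_{A_i A_o} ⊗ 1_{B_i}` -/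
  not_bob_to_alice : ∃ L : Matrix (ai × ao) (ai × ao) ℂ, ∀ x x' i i' k k',
    ∑ p, J (x, i, k, p) (x', i', k', p) = L (x, i) (x', i') * (1 : Matrix bi bi ℂ) k k'

/-- The effective channel `Π(W)` from `A_i` to `B_o`, obtained by connecting Alice's output `A_o`
to Bob's input `B_i` of the bipartite channel with Choi matrix `J` through `W`. -/
def effective {ai ao bi bo : Type*} [Fintype ai] [Fintype ao] [DecidableEq ao] [Fintype bi]
    (J : Matrix (ai × ao × bi × bo) (ai × ao × bi × bo) ℂ)
    (W : Matrix ao ao ℂ →ₗ[ℂ] Matrix bi bi ℂ) :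
    Matrix ai ai ℂ →ₗ[ℂ] Matrix bo bo ℂ :=
  ofChoi (Matrix.of fun p q =>
    ∑ i, ∑ j, ∑ k, ∑ l, J (p.1, i, k, p.2) (q.1, j, l, q.2) * choi W (i, k) (j, l))

/-- Average success probability `1/M ∑ m, ⟨m| Π(W)(|m⟩⟨m|) |m⟩` of the code `J` for `M` messages. -/
def successProb {a b : Type*} [Fintype a] [DecidableEq a] [Fintype b] {M : ℕ}
    (J : Matrix (Fin M × a × b × Fin M) (Fin M × a × b × Fin M) ℂ)
    (W : Matrix a a ℂ →ₗ[ℂ] Matrix b b ℂ) : ℝ :=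
  (1 / (M : ℝ)) * ∑ m : Fin M, (effective J W (Matrix.single m m 1) m m).re

/-- `ε^NS(M, W)`: the optimal error probability for sending one of `M` messages over `W` with
non-signaling assistance. -/
def nsError {a b : Type*} [Fintype a] [DecidableEq a] [Fintype b] [DecidableEq b] (M : ℕ)
    (W : Matrix a a ℂ →ₗ[ℂ] Matrix b b ℂ) : ℝ :=
  1 - sSup {s : ℝ | ∃ J : Matrix (Fin M × a × b × Fin M) (Fin M × a × b × Fin M) ℂ,
    IsNonSignaling J ∧ s = successProb J W}

/-- The activated non-signaling error exponent
`liminf_n -(1/n) log ε^NS(⌈e^{nr}⌉, W^{⊗ n} ⊗ I_2)`, with `log 0 = -∞`. -/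
def ansExponent {a b : Type*} [Fintype a] [DecidableEq a] [Fintype b] [DecidableEq b]
    (W : Matrix a a ℂ →ₗ[ℂ] Matrix b b ℂ) (r : ℝ) : EReal :=
  liminf (fun n : ℕ => ((1 / (n : ℝ) : ℝ) : EReal) *
    (-ENNReal.log (ENNReal.ofReal
      (nsError ⌈Real.exp (n * r)⌉₊ (tensor (tensorPow n W) bitChannel))))) atTop

/-- The Umegaki relative entropy `Tr ρ (log ρ - log σ)`, equal to `+∞` unless the support of `ρ`
is included in that of `σ`. -/
def relEntropy {a : Type*} [Fintype a] [DecidableEq a] (ρ σ : Matrix a a ℂ) : EReal :=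
  open Classical in
  if ∀ v : a → ℂ, σ *ᵥ v = 0 → ρ *ᵥ v = 0 then
    (((ρ * (cfc Real.log ρ - cfc Real.log σ)).trace.re : ℝ) : EReal)
  else ⊤

/-- The Petz Rényi divergence `1/(α-1) log Tr (ρ^α σ^(1-α))` of order `α ∈ (0, 1)`, extended by
the Umegaki relative entropy at `α = 1`. It is `+∞` for `α < 1` exactly if the trace vanishes. -/
def petzRenyi {a : Type*} [Fintype a] [DecidableEq a] (α : ℝ) (ρ σ : Matrix a a ℂ) : EReal :=
  if α = 1 then relEntropy ρ σ
  else (((α - 1)⁻¹ : ℝ) : EReal) * ENNReal.log (ENNReal.ofReal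
    (cfc (fun x : ℝ => x ^ α) ρ * cfc (fun x : ℝ => x ^ (1 - α)) σ).trace.re)

/-- The state `√ρ_R J √ρ_R`, where `√ρ_R` acts on the first factor. -/
def inputState {a b : Type*} [Fintype a] [DecidableEq a] [Fintype b] [DecidableEq b]
    (ρ : Matrix a a ℂ) (J : Matrix (a × b) (a × b) ℂ) : Matrix (a × b) (a × b) ℂ :=
  (cfc Real.sqrt ρ ⊗ₖ (1 : Matrix b b ℂ)) * J * (cfc Real.sqrt ρ ⊗ₖ (1 : Matrix b b ℂ))

end QExp

end

/-! Fix an input state `ρ`, put `A = √ρ J_W √ρ`, `G = Tr_R A^α ρ^(1-α)` and `g = Tr G^(1/α)`. For `α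
< 1` the heart of the proof is a one-shot bound: with one noiseless bit added, the non-signaling
error for `M` messages is at most `M^((1-α)/α) g`.

Coding side: any `Λ` with `0 ≤ Λ ≤ ρ ⊗ 1` and `Tr_A Λ ≤ 1/M` gives an activated code with error at
most `1 - Tr Λᵀ J` (`nsError_tensor_bitChannel_le`). Without the bit, a code of this form needs
equality in the marginal constraint; the bit makes room for padding that never affects the success
probability.

Testing side: with `Λ = (√ρ T √ρ)ᵀ`, used with the input state `ρᵀ`, the error becomes `Tr (1-T) A`
for a test `T` subject to `Tr_R √ρ T √ρ ≤ 1/M`. Lagrange duality (`exists_constrained_test`)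
replaces the constraint by a multiplier `Y ≥ 0`, that is, by testing `A` against `ρ ⊗ Y`.
Audenaert's inequality (`exists_test_le`) bounds the total error by `Tr A^α (ρ ⊗ Y)^(1-α) = Tr G
Y^(1-α)`, and Young's inequality (`trace_mul_rpow_le`) bounds this by `M^((1-α)/α) g + Tr Y / M`,
uniformly in `Y` after subtracting the penalty.

The quantity `g` is multiplicative under tensor powers, so the exponent is at least `-log g - r
(1-α)/α`. Sibson's state `σ = G^(1/α) / g` turns this number into the Rényi expression; since an
infimum over `σ` is to be bounded above, one `σ` suffices. At `α = 1` the prefactor vanishes and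
only nonnegativity of the exponent is needed. -/

noncomputable section

namespace QExp

/-! ### Diagonalization and the functional calculus -/

/-- `A = U diag(d) U*` with `U` unitary and `d` real. -/
structure Diagonalizes {n : Type*} [Fintype n] [DecidableEq n] (U : Matrix n n ℂ) (d : n → ℝ)
    (A : Matrix n n ℂ) : Prop where
  unitary : Uᴴ * U = 1
  eq : A = U * diagonal (fun i => (d i : ℂ)) * Uᴴ

section Diagonalizes

variable {n m : Type*} [Fintype n] [DecidableEq n] [Fintype m] [DecidableEq m]

theorem exists_diagonalizes {A : Matrix n n ℂ} (hA : A.IsHermitian) :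
    ∃ U d, Diagonalizes U d A := by
  refine ⟨hA.eigenvectorUnitary, hA.eigenvalues, ?_, ?_⟩
  · exact Unitary.coe_star_mul_self hA.eigenvectorUnitary
  · conv_lhs => rw [hA.spectral_theorem, Unitary.conjStarAlgAut_apply]
    rfl

namespace Diagonalizes

variable {U : Matrix n n ℂ} {d : n → ℝ} {A : Matrix n n ℂ}
  {V : Matrix m m ℂ} {e : m → ℝ} {B : Matrix m m ℂ}

theorem unitary' (h : Diagonalizes U d A) : U * Uᴴ = 1 := mul_eq_one_comm.mp h.unitary

theorem isHermitian (h : Diagonalizes U d A) : A.IsHermitian := by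
  rw [h.eq]
  refine isHermitian_mul_mul_conjTranspose _ (isHermitian_diagonal_of_self_adjoint _ ?_)
  ext i
  simp

/-- The algebra homomorphism `g ↦ U diag(g) U*`. -/
def algHom (hU : Uᴴ * U = 1) : (n → ℝ) →ₐ[ℝ] Matrix n n ℂ where
  toFun g := U * diagonal (fun i => (g i : ℂ)) * Uᴴ
  map_one' := by simpa using mul_eq_one_comm.mp hU
  map_mul' f g := by
    have : (diagonal fun i => ((f * g) i : ℂ)) =
        diagonal (fun i => (f i : ℂ)) * diagonal (fun i => (g i : ℂ)) := by
      simp [diagonal_mul_diagonal]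
    rw [this]
    simp only [Matrix.mul_assoc]
    rw [← Matrix.mul_assoc Uᴴ U, hU, Matrix.one_mul]
  map_zero' := by simp
  map_add' f g := by
    rw [← Matrix.add_mul, ← Matrix.mul_add, diagonal_add]
    simp
  commutes' r := by
    have : (diagonal fun i => ((algebraMap ℝ (n → ℝ) r) i : ℂ)) = (r : ℂ) • (1 : Matrix n n ℂ) := by
      ext i j
      by_cases h : i = j <;> simp [h]
    rw [this, Matrix.mul_smul, Matrix.smul_mul, Matrix.mul_one, mul_eq_one_comm.mp hU,
      Algebra.algebraMap_eq_smul_one]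
    ext i j
    simp

/-- On the finitely many eigenvalues `f` agrees with its Lagrange interpolation polynomial, and
polynomials commute with the algebra homomorphism `algHom`. No continuity of `f` is required. -/
theorem cfc (h : Diagonalizes U d A) (f : ℝ → ℝ) : Diagonalizes U (f ∘ d) (cfc f A) := by
  refine ⟨h.unitary, ?_⟩
  have hA : algHom h.unitary d = A := h.eq.symm
  obtain ⟨q, hq⟩ : ∃ q : Polynomial ℝ, ∀ i, q.eval (d i) = f (d i) := by
    refine ⟨Lagrange.interpolate (Finset.univ.image d) id f, fun i => ?_⟩
    exact Lagrange.eval_interpolate_at_node (s := Finset.univ.image d) (v := id) f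
      Function.injective_id.injOn (Finset.mem_image_of_mem d (Finset.mem_univ i))
  have hspec : spectrum ℝ A ⊆ Set.range d := by
    rw [← hA]
    refine (AlgHom.spectrum_apply_subset _ _).trans ?_
    rw [Pi.spectrum_eq]
    intro x hx
    obtain ⟨i, hi⟩ := Set.mem_iUnion.mp hx
    refine ⟨i, ?_⟩
    by_contra hne
    refine hi (IsUnit.mk0 _ ?_)
    simpa [sub_eq_zero] using Ne.symm hne
  have : _root_.cfc f A = Polynomial.aeval A q := by
    rw [← cfc_polynomial q A h.isHermitian]
    refine cfc_congr fun x hx => ?_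
    obtain ⟨i, rfl⟩ := hspec hx
    exact (hq i).symm
  rw [this, ← hA, Polynomial.aeval_algHom_apply]
  change U * _ * Uᴴ = _
  congr 3
  ext i
  have : (Polynomial.aeval d q) i = q.eval (d i) := by simp
  rw [this, hq]
  rfl

theorem nonneg (h : Diagonalizes U d A) (hA : A.PosSemidef) (i : n) : 0 ≤ d i := by
  have h1 := (hA.conjTranspose_mul_mul_same U).diag_nonneg (i := i)
  have h2 : Uᴴ * A * U = diagonal (fun i => (d i : ℂ)) := by
    rw [h.eq]
    simp only [Matrix.mul_assoc]
    rw [h.unitary, Matrix.mul_one, ← Matrix.mul_assoc, h.unitary, Matrix.one_mul]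
  rw [h2, diagonal_apply_eq] at h1
  exact_mod_cast h1

theorem posSemidef (h : Diagonalizes U d A) (hd : ∀ i, 0 ≤ d i) : A.PosSemidef := by
  rw [h.eq]
  refine PosSemidef.mul_mul_conjTranspose_same (PosSemidef.diagonal fun i => ?_) U
  simpa using hd i

theorem trace_eq (h : Diagonalizes U d A) : A.trace = ((∑ i, d i : ℝ) : ℂ) := by
  rw [h.eq, Matrix.trace_mul_comm, ← Matrix.mul_assoc, h.unitary, Matrix.one_mul]
  simp [Matrix.trace]

theorem kronecker (h : Diagonalizes U d A) (h' : Diagonalizes V e B) :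
    Diagonalizes (U ⊗ₖ V) (fun p => d p.1 * e p.2) (A ⊗ₖ B) := by
  refine ⟨?_, ?_⟩
  · rw [conjTranspose_kronecker, ← mul_kronecker_mul, h.unitary, h'.unitary, one_kronecker_one]
  · rw [conjTranspose_kronecker, h.eq, h'.eq, mul_kronecker_mul, mul_kronecker_mul,
      diagonal_kronecker_diagonal]
    simp

theorem submatrix (h : Diagonalizes U d A) (σ : m ≃ n) :
    Diagonalizes (U.submatrix σ σ) (d ∘ σ) (A.submatrix σ σ) := by
  refine ⟨?_, ?_⟩
  · rw [conjTranspose_submatrix, submatrix_mul_equiv, h.unitary, submatrix_one_equiv]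
  · have : (diagonal fun i => (((d ∘ σ) i : ℝ) : ℂ)) =
        (diagonal fun i => (d i : ℂ)).submatrix σ σ := by
      rw [submatrix_diagonal_equiv]; rfl
    rw [this, conjTranspose_submatrix, submatrix_mul_equiv, submatrix_mul_equiv, ← h.eq]

theorem smul (h : Diagonalizes U d A) (c : ℝ) :
    Diagonalizes U (fun i => c * d i) ((c : ℂ) • A) := by
  refine ⟨h.unitary, ?_⟩
  have : (diagonal fun i => ((c * d i : ℝ) : ℂ)) = (c : ℂ) • diagonal fun i => (d i : ℂ) := by
    ext i j
    by_cases h : i = j <;> simp [h]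
  rw [this, Matrix.mul_smul, Matrix.smul_mul, ← h.eq]

theorem mul {e : n → ℝ} {B : Matrix n n ℂ} (h : Diagonalizes U d A) (h' : Diagonalizes U e B) :
    Diagonalizes U (fun i => d i * e i) (A * B) := by
  refine ⟨h.unitary, ?_⟩
  rw [h.eq, h'.eq]
  simp only [Matrix.mul_assoc]
  rw [← Matrix.mul_assoc Uᴴ U, h.unitary, Matrix.one_mul, ← Matrix.mul_assoc (diagonal _),
    diagonal_mul_diagonal]
  simp

theorem sub {e : n → ℝ} {B : Matrix n n ℂ} (h : Diagonalizes U d A) (h' : Diagonalizes U e B) :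
    Diagonalizes U (fun i => d i - e i) (A - B) := by
  refine ⟨h.unitary, ?_⟩
  rw [h.eq, h'.eq, ← Matrix.sub_mul, ← Matrix.mul_sub, diagonal_sub]
  simp

theorem ext_of_eq {e : n → ℝ} {B : Matrix n n ℂ} (h : Diagonalizes U d A)
    (h' : Diagonalizes U e B) (hde : ∀ i, d i = e i) : A = B := by
  rw [h.eq, h'.eq, funext hde]

theorem one (hU : Uᴴ * U = 1) : Diagonalizes U (fun _ => 1) 1 :=
  ⟨hU, by simpa using (mul_eq_one_comm.mp hU).symm⟩

/-- The overlaps of two eigenbases form a doubly stochastic matrix (`sum_normSq`, `sum_normSq'`), so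
trace inequalities for noncommuting matrices reduce to scalar ones. -/
theorem trace_mul_eq {V : Matrix n n ℂ} {e : n → ℝ} {B : Matrix n n ℂ}
    (h : Diagonalizes U d A) (h' : Diagonalizes V e B) :
    (A * B).trace = ((∑ i, ∑ j, d i * e j * Complex.normSq ((Uᴴ * V) i j) : ℝ) : ℂ) := by
  have : (A * B).trace = (diagonal (fun i => (d i : ℂ)) * (Uᴴ * V) *
      (diagonal (fun i => (e i : ℂ)) * (Uᴴ * V)ᴴ)).trace := by
    rw [h.eq, h'.eq, conjTranspose_mul, conjTranspose_conjTranspose, Matrix.mul_assoc,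
      Matrix.mul_assoc, Matrix.trace_mul_comm]
    simp only [Matrix.mul_assoc]
  rw [this, Matrix.trace]
  push_cast
  refine Finset.sum_congr rfl fun i _ => ?_
  rw [diag_apply, Matrix.mul_apply]
  refine Finset.sum_congr rfl fun j _ => ?_
  rw [diagonal_mul, diagonal_mul, conjTranspose_apply, ← Complex.mul_conj]
  simp only [Complex.star_def]
  ring

theorem sum_normSq {V : Matrix n n ℂ} (hU : Uᴴ * U = 1) (hV : Vᴴ * V = 1) (i : n) :
    ∑ j, Complex.normSq ((Uᴴ * V) i j) = 1 := by
  have h : ((Uᴴ * V) * (Uᴴ * V)ᴴ) i i = 1 := by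
    rw [conjTranspose_mul, conjTranspose_conjTranspose, Matrix.mul_assoc, ← Matrix.mul_assoc V,
      mul_eq_one_comm.mp hV, Matrix.one_mul, hU, one_apply_eq]
  rw [Matrix.mul_apply] at h
  have h2 : ((∑ j, Complex.normSq ((Uᴴ * V) i j) : ℝ) : ℂ) = 1 := by
    rw [← h]
    push_cast
    refine Finset.sum_congr rfl fun j _ => ?_
    rw [conjTranspose_apply, ← Complex.mul_conj]
    rfl
  exact_mod_cast h2

theorem sum_normSq' {V : Matrix n n ℂ} (hU : Uᴴ * U = 1) (hV : Vᴴ * V = 1) (j : n) :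
    ∑ i, Complex.normSq ((Uᴴ * V) i j) = 1 := by
  rw [← sum_normSq hV hU j]
  refine Finset.sum_congr rfl fun i _ => ?_
  have : (Vᴴ * U) j i = star ((Uᴴ * V) i j) := by
    rw [← conjTranspose_apply, conjTranspose_mul, conjTranspose_conjTranspose]
  rw [this]
  simp

end Diagonalizes

theorem trace_cfc_eq {U : Matrix n n ℂ} {d : n → ℝ} {A : Matrix n n ℂ} (h : Diagonalizes U d A)
    (f : ℝ → ℝ) : (cfc f A).trace.re = ∑ i, f (d i) := by
  rw [(h.cfc f).trace_eq, Complex.ofReal_re]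
  rfl

theorem posSemidef_cfc {A : Matrix n n ℂ} (hA : A.PosSemidef) {f : ℝ → ℝ}
    (hf : ∀ x, 0 ≤ x → 0 ≤ f x) : (cfc f A).PosSemidef := by
  obtain ⟨U, d, h⟩ := exists_diagonalizes hA.isHermitian
  exact (h.cfc f).posSemidef fun i => hf _ (h.nonneg hA i)

theorem cfc_mul_cfc {A : Matrix n n ℂ} (hA : A.PosSemidef) {f g k : ℝ → ℝ}
    (h : ∀ x, 0 ≤ x → f x * g x = k x) : cfc f A * cfc g A = cfc k A := by
  obtain ⟨U, d, hd⟩ := exists_diagonalizes hA.isHermitian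
  exact ((hd.cfc f).mul (hd.cfc g)).ext_of_eq (hd.cfc k) fun i => h _ (hd.nonneg hA i)

theorem cfc_eq_self_of_forall {A : Matrix n n ℂ} (hA : A.PosSemidef) {f : ℝ → ℝ}
    (h : ∀ x, 0 ≤ x → f x = x) : cfc f A = A := by
  obtain ⟨U, d, hd⟩ := exists_diagonalizes hA.isHermitian
  exact (hd.cfc f).ext_of_eq hd fun i => h _ (hd.nonneg hA i)

theorem cfc_kronecker {A : Matrix n n ℂ} {B : Matrix m m ℂ} (hA : A.PosSemidef)
    (hB : B.PosSemidef) {f : ℝ → ℝ} (hf : ∀ x y, 0 ≤ x → 0 ≤ y → f (x * y) = f x * f y) :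
    cfc f (A ⊗ₖ B) = cfc f A ⊗ₖ cfc f B := by
  obtain ⟨U, d, h⟩ := exists_diagonalizes hA.isHermitian
  obtain ⟨V, e, h'⟩ := exists_diagonalizes hB.isHermitian
  exact ((h.kronecker h').cfc f).ext_of_eq ((h.cfc f).kronecker (h'.cfc f))
    fun p => hf _ _ (h.nonneg hA _) (h'.nonneg hB _)

theorem cfc_submatrix {A : Matrix n n ℂ} (hA : A.IsHermitian) (σ : m ≃ n) (f : ℝ → ℝ) :
    cfc f (A.submatrix σ σ) = (cfc f A).submatrix σ σ := by
  obtain ⟨U, d, h⟩ := exists_diagonalizes hA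
  exact ((h.submatrix σ).cfc f).ext_of_eq ((h.cfc f).submatrix σ) fun _ => rfl

/-- Traces of products of positive semidefinite matrices are nonnegative. -/
theorem trace_mul_nonneg {A B : Matrix n n ℂ} (hA : A.PosSemidef) (hB : B.PosSemidef) :
    0 ≤ (A * B).trace.re := by
  obtain ⟨U, d, h⟩ := exists_diagonalizes hA.isHermitian
  obtain ⟨V, e, h'⟩ := exists_diagonalizes hB.isHermitian
  rw [h.trace_mul_eq h', Complex.ofReal_re]
  exact Finset.sum_nonneg fun i _ => Finset.sum_nonneg fun j _ =>
    mul_nonneg (mul_nonneg (h.nonneg hA i) (h'.nonneg hB j)) (Complex.normSq_nonneg _)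

/-- A trace form of Young's inequality. -/
theorem trace_mul_rpow_le {G Y : Matrix n n ℂ} (hG : G.PosSemidef) (hY : Y.PosSemidef)
    {α M : ℝ} (hα : 0 < α) (hα' : α < 1) (hM : 0 < M) :
    (G * cfc (fun x : ℝ => x ^ (1 - α)) Y).trace.re - M⁻¹ * Y.trace.re ≤
      M ^ ((1 - α) / α) * (cfc (fun x : ℝ => x ^ (1 / α)) G).trace.re := by
  obtain ⟨U, g, h⟩ := exists_diagonalizes hG.isHermitian
  obtain ⟨V, y, h'⟩ := exists_diagonalizes hY.isHermitian
  have hg := h.nonneg hG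
  have hy := h'.nonneg hY
  rw [h.trace_mul_eq (h'.cfc _), trace_cfc_eq h, h'.trace_eq, Complex.ofReal_re, Complex.ofReal_re]
  set p : n → n → ℝ := fun i j => Complex.normSq ((Uᴴ * V) i j)
  have hp : ∀ i j, 0 ≤ p i j := fun i j => Complex.normSq_nonneg _
  have key : ∀ i j, g i * y j ^ (1 - α) ≤ M ^ ((1 - α) / α) * g i ^ (1 / α) + M⁻¹ * y j := by
    -- Weighted AM-GM with weights `α` and `1 - α`, applied to `(g M^(1-α))^(1/α)` and `y / M`: the
    -- powers of `M` cancel in the geometric mean. The weights on the right are then bounded by 1.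
    intro i j
    have hx : 0 ≤ g i * M ^ (1 - α) := mul_nonneg (hg i) (Real.rpow_nonneg hM.le _)
    have hz : 0 ≤ M⁻¹ * y j := mul_nonneg (inv_nonneg.mpr hM.le) (hy j)
    have hw := Real.geom_mean_le_arith_mean2_weighted hα.le (sub_nonneg.mpr hα'.le)
      (Real.rpow_nonneg hx (1 / α)) hz (by ring)
    have e1 : ((g i * M ^ (1 - α)) ^ (1 / α)) ^ α = g i * M ^ (1 - α) := by
      rw [← Real.rpow_mul hx, one_div, inv_mul_cancel₀ hα.ne', Real.rpow_one]
    have e2 : (g i * M ^ (1 - α)) ^ (1 / α) = M ^ ((1 - α) / α) * g i ^ (1 / α) := by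
      rw [Real.mul_rpow (hg i) (Real.rpow_nonneg hM.le _), ← Real.rpow_mul hM.le, mul_comm]
      congr 2
      ring
    have e3 : (M⁻¹ * y j) ^ (1 - α) = (M ^ (1 - α))⁻¹ * y j ^ (1 - α) := by
      rw [Real.mul_rpow (inv_nonneg.mpr hM.le) (hy j), Real.inv_rpow hM.le]
    have e4 : M ^ (1 - α) ≠ 0 := (Real.rpow_pos_of_pos hM _).ne'
    rw [e1, e3, e2] at hw
    have e5 : g i * M ^ (1 - α) * ((M ^ (1 - α))⁻¹ * y j ^ (1 - α)) = g i * y j ^ (1 - α) := by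
      field_simp
    rw [e5] at hw
    have h3 : 0 ≤ M ^ ((1 - α) / α) * g i ^ (1 / α) :=
      mul_nonneg (Real.rpow_nonneg hM.le _) (Real.rpow_nonneg (hg i) _)
    nlinarith
  have hrow : ∀ i, ∑ j, p i j = 1 := Diagonalizes.sum_normSq h.unitary h'.unitary
  have hcol : ∀ j, ∑ i, p i j = 1 := Diagonalizes.sum_normSq' h.unitary h'.unitary
  have h1 : ∑ i, ∑ j, g i * y j ^ (1 - α) * p i j ≤
      ∑ i, ∑ j, (M ^ ((1 - α) / α) * g i ^ (1 / α) + M⁻¹ * y j) * p i j :=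
    Finset.sum_le_sum fun i _ => Finset.sum_le_sum fun j _ =>
      mul_le_mul_of_nonneg_right (key i j) (hp i j)
  have h2 : ∑ i, ∑ j, (M ^ ((1 - α) / α) * g i ^ (1 / α) + M⁻¹ * y j) * p i j =
      M ^ ((1 - α) / α) * ∑ i, g i ^ (1 / α) + M⁻¹ * ∑ j, y j := by
    simp only [add_mul, Finset.sum_add_distrib]
    congr 1
    · simp only [← Finset.mul_sum, hrow, mul_one]
    · rw [Finset.sum_comm]
      simp only [← Finset.mul_sum, hcol, mul_one]
  simp only [Function.comp_apply]
  linarith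

end Diagonalizes

/-! ### Quantum hypothesis testing -/

section Test

variable {n : Type*} [Fintype n] [DecidableEq n]

section

open scoped MatrixOrder Matrix.Norms.L2Operator

/-- Operator monotonicity of `x ↦ x ^ s` for `0 ≤ s ≤ 1`. -/
theorem posSemidef_rpow_sub_rpow {A B : Matrix n n ℂ} (hA : A.PosSemidef)
    (hAB : (B - A).PosSemidef) {s : ℝ} (hs : 0 ≤ s) (hs' : s ≤ 1) :
    (cfc (fun x : ℝ => x ^ s) B - cfc (fun x : ℝ => x ^ s) A).PosSemidef := by
  have hA' : 0 ≤ A := nonneg_iff_posSemidef.mpr hA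
  have hle : A ≤ B := hAB
  have h := CFC.rpow_le_rpow (p := s) ⟨hs, hs'⟩ hle
  rw [CFC.rpow_eq_cfc_real hA', CFC.rpow_eq_cfc_real (hA'.trans hle)] at h
  exact h

/-- The set of tests `0 ≤ T ≤ 1` is compact. -/
theorem isCompact_tests :
    IsCompact {T : Matrix n n ℂ | T.PosSemidef ∧ (1 - T).PosSemidef} := by
  have h : {T : Matrix n n ℂ | T.PosSemidef ∧ (1 - T).PosSemidef} = Set.Icc 0 1 := by
    ext T
    rw [Set.mem_Icc, nonneg_iff_posSemidef]
    rfl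
  rw [h]
  refine Metric.isCompact_of_isClosed_isBounded isClosed_Icc ?_
  refine (Metric.isBounded_closedBall (x := (0 : Matrix n n ℂ)) (r := 1)).subset fun T hT => ?_
  rw [mem_closedBall_zero_iff]
  exact (CStarAlgebra.norm_le_one_iff_of_nonneg T hT.1).mpr hT.2

theorem isClosed_posSemidef : IsClosed {P : Matrix n n ℂ | P.PosSemidef} := by
  have h : {P : Matrix n n ℂ | P.PosSemidef} = Set.Ici 0 := by
    ext T
    rw [Set.mem_Ici, nonneg_iff_posSemidef]
    rfl
  rw [h]
  exact isClosed_Ici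

end

theorem trace_mul_le_trace_mul {A B C : Matrix n n ℂ} (hAB : (B - A).PosSemidef)
    (hC : C.PosSemidef) : (A * C).trace.re ≤ (B * C).trace.re := by
  have := trace_mul_nonneg hAB hC
  rw [Matrix.sub_mul, Matrix.trace_sub, Complex.sub_re] at this
  linarith

theorem rpow_mul_rpow_one_sub {x : ℝ} (hx : 0 ≤ x) (s : ℝ) :
    x ^ s * x ^ (1 - s) = x := by
  rw [← Real.rpow_add' hx (by simp), add_sub_cancel, Real.rpow_one]

/-- Audenaert's inequality: the optimal test between `A` and `B` has total error at most
`Tr A^s B^(1-s)`. -/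
theorem exists_test_le {A B : Matrix n n ℂ} (hA : A.PosSemidef) (hB : B.PosSemidef) {s : ℝ}
    (hs : 0 < s) (hs' : s < 1) : ∃ T : Matrix n n ℂ, T.PosSemidef ∧ (1 - T).PosSemidef ∧
      ((1 - T) * A).trace.re + (T * B).trace.re ≤
        (cfc (fun x : ℝ => x ^ s) A * cfc (fun x : ℝ => x ^ (1 - s)) B).trace.re := by
  obtain ⟨U, d, h⟩ := exists_diagonalizes (hA.isHermitian.sub hB.isHermitian)
  -- The Neyman–Pearson test, projecting onto the positive part `D` of `A - B`; its total error is
  -- `Tr A - Tr D`.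
  have hT := h.cfc fun x => if 0 < x then 1 else 0
  have hD := h.cfc fun x => max x 0
  set T := cfc (fun x : ℝ => if 0 < x then (1 : ℝ) else 0) (A - B)
  set D := cfc (fun x : ℝ => max x 0) (A - B)
  have hTD : T * (A - B) = D := by
    refine (hT.mul h).ext_of_eq hD fun i => ?_
    simp only [Function.comp_apply]
    split_ifs with hi
    · rw [max_eq_left hi.le, one_mul]
    · rw [max_eq_right (not_lt.mp hi), zero_mul]
  have hDpos : D.PosSemidef := hD.posSemidef fun i => le_max_right _ _
  have hCA : (B + D - A).PosSemidef := by
    have : B + D - A = D - (A - B) := by abel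
    rw [this]
    exact (hD.sub h).posSemidef fun i => sub_nonneg.mpr (le_max_left _ _)
  have hCB : (B + D - B).PosSemidef := by simpa using hDpos
  refine ⟨T, hT.posSemidef fun i => ?_,
    ((Diagonalizes.one h.unitary).sub hT).posSemidef fun i => ?_, ?_⟩
  · simp only [Function.comp_apply]; split_ifs <;> norm_num
  · simp only [Function.comp_apply]; split_ifs <;> norm_num
  have hC : (B + D).PosSemidef := hB.add hDpos
  have ht : 0 ≤ 1 - s := by linarith
  have ht' : 1 - s ≤ 1 := by linarith
  set p : ℝ → ℝ := fun x => x ^ s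
  set q : ℝ → ℝ := fun x => x ^ (1 - s)
  have hpq : ∀ X : Matrix n n ℂ, X.PosSemidef → cfc q X * cfc p X = X := fun X hX => by
    rw [cfc_mul_cfc hX (k := fun x => x) fun x hx => by
      simpa [p, q, mul_comm] using rpow_mul_rpow_one_sub hx s]
    exact cfc_eq_self_of_forall hX fun x _ => rfl
  have hp : ∀ X : Matrix n n ℂ, X.PosSemidef → (cfc p X).PosSemidef := fun X hX =>
    posSemidef_cfc hX fun x hx => Real.rpow_nonneg hx _
  have hq : ∀ X : Matrix n n ℂ, X.PosSemidef → (cfc q X).PosSemidef := fun X hX =>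
    posSemidef_cfc hX fun x hx => Real.rpow_nonneg hx _
  -- Write `C = B + D`, which dominates both `A` and `B`; then `C^t ≥ A^t, B^t` for `t = s, 1-s`.
  -- The three inequalities chain as `Tr A - Tr B^(1-s) A^s ≤ Tr (C^(1-s) - B^(1-s)) A^s ≤ Tr
  -- (C^(1-s) - B^(1-s)) C^s ≤ Tr C - Tr B = Tr D`.
  have m1 := trace_mul_le_trace_mul (posSemidef_rpow_sub_rpow hA hCA ht ht') (hp A hA)
  have m2 := trace_mul_nonneg (posSemidef_rpow_sub_rpow hB hCB ht ht')
    (posSemidef_rpow_sub_rpow hA hCA hs.le hs'.le)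
  have m3 := trace_mul_nonneg (hq B hB) (posSemidef_rpow_sub_rpow hB hCB hs.le hs'.le)
  change (cfc q A * cfc p A).trace.re ≤ (cfc q (B + D) * cfc p A).trace.re at m1
  change 0 ≤ ((cfc q (B + D) - cfc q B) * (cfc p (B + D) - cfc p A)).trace.re at m2
  change 0 ≤ (cfc q B * (cfc p (B + D) - cfc p B)).trace.re at m3
  rw [Matrix.sub_mul, Matrix.mul_sub, Matrix.mul_sub, hpq _ hC] at m2
  rw [Matrix.mul_sub, hpq _ hB] at m3
  rw [hpq _ hA] at m1
  have e1 : ((1 - T) * A).trace.re + (T * B).trace.re = A.trace.re - D.trace.re := by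
    rw [← hTD, Matrix.mul_sub, Matrix.sub_mul, Matrix.one_mul]
    simp only [Matrix.trace_sub, Complex.sub_re]
    ring
  rw [e1, Matrix.trace_mul_comm]
  simp only [Matrix.trace_sub, Matrix.trace_add, Complex.sub_re, Complex.add_re] at m2 m3
  linarith

end Test

/-! ### Lagrange duality for tests -/

section Duality

variable {n b : Type*} [Fintype n] [DecidableEq n] [Fintype b] [DecidableEq b]

/-- Real functionals on matrices are represented by the trace pairing. -/
theorem exists_eq_trace_re (g : Matrix b b ℂ →ₗ[ℝ] ℝ) :
    ∃ Y : Matrix b b ℂ, ∀ P, g P = (Y * P).trace.re := by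
  refine ⟨Matrix.of fun j i => (g (single i j 1) : ℂ) - Complex.I * g (single i j Complex.I),
    fun P => ?_⟩
  have hP : P = ∑ i, ∑ j, ((P i j).re • single i j (1 : ℂ) +
      (P i j).im • single i j Complex.I) := by
    conv_lhs => rw [matrix_eq_sum_single P]
    refine Finset.sum_congr rfl fun i _ => Finset.sum_congr rfl fun j _ => ?_
    rw [smul_single, smul_single, ← single_add]
    congr 1
    simp
  conv_lhs => rw [hP]
  simp only [map_sum, map_add, map_smul, Matrix.trace, diag_apply, Matrix.mul_apply, of_apply,
    Complex.re_sum]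
  rw [Finset.sum_comm]
  refine Finset.sum_congr rfl fun i _ => Finset.sum_congr rfl fun j _ => ?_
  simp
  ring

/-- Real functionals that are nonnegative on positive semidefinite matrices are represented, on
Hermitian matrices, by positive semidefinite matrices. -/
theorem exists_posSemidef_eq_trace_re (g : Matrix b b ℂ →ₗ[ℝ] ℝ)
    (hg : ∀ P : Matrix b b ℂ, P.PosSemidef → 0 ≤ g P) :
    ∃ Y : Matrix b b ℂ, Y.PosSemidef ∧ ∀ P, P.IsHermitian → g P = (Y * P).trace.re := by
  obtain ⟨Z, hZ⟩ := exists_eq_trace_re g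
  set Y : Matrix b b ℂ := (1 / 2 : ℝ) • (Z + Zᴴ) with hYdef
  have hY : Y.IsHermitian := by
    ext i j
    simp [hYdef, add_comm]
  have hrep : ∀ P : Matrix b b ℂ, P.IsHermitian → g P = (Y * P).trace.re := fun P hP => by
    have h1 : (Zᴴ * P).trace.re = (Z * P).trace.re := by
      have : (Zᴴ * P) = (P * Z)ᴴ := by rw [conjTranspose_mul, hP.eq]
      rw [this, trace_conjTranspose, Matrix.trace_mul_comm]
      simp
    rw [hYdef, Matrix.smul_mul, Matrix.trace_smul, Matrix.add_mul, Matrix.trace_add,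
      Complex.real_smul, Complex.re_ofReal_mul, Complex.add_re, h1, ← hZ]
    ring
  obtain ⟨U, d, h⟩ := exists_diagonalizes hY
  refine ⟨Y, h.posSemidef fun i => ?_, hrep⟩
  -- Evaluating `g` on the projection onto the `i`-th eigenvector of `Y` returns the eigenvalue `d
  -- i`.
  have hP : Diagonalizes U (Pi.single i 1) (U * diagonal (fun j => ((Pi.single i 1 : b → ℝ) j : ℂ))
    * Uᴴ) := ⟨h.unitary, rfl⟩
  have h2 := hg _ (hP.posSemidef fun j => by by_cases hj : j = i <;> simp [hj])
  rw [hrep _ hP.isHermitian, (h.mul hP).trace_eq, Complex.ofReal_re] at h2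
  simpa [Pi.single_apply] using h2

/-- Lagrange duality for tests `T` under an operator constraint `R T ≤ c`. -/
theorem exists_constrained_test (A : Matrix n n ℂ) (R : Matrix n n ℂ →ₗ[ℂ] Matrix b b ℂ)
    (hR : ∀ T : Matrix n n ℂ, T.PosSemidef → (R T).PosSemidef) {c e : ℝ} (hc : 0 < c)
    (h : ∀ Y : Matrix b b ℂ, Y.PosSemidef → ∃ T : Matrix n n ℂ, T.PosSemidef ∧
      (1 - T).PosSemidef ∧
      ((1 - T) * A).trace.re + (R T * Y).trace.re - c * Y.trace.re ≤ e) :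
    ∃ T : Matrix n n ℂ, T.PosSemidef ∧ (1 - T).PosSemidef ∧ ((1 - T) * A).trace.re ≤ e ∧
      ((c : ℂ) • (1 : Matrix b b ℂ) - R T).PosSemidef := by
  by_contra hno
  have : LocallyConvexSpace ℝ (Matrix b b ℂ) :=
    inferInstanceAs (LocallyConvexSpace ℝ (b → b → ℂ))
  set K : Set (Matrix n n ℂ) := {T | T.PosSemidef ∧ (1 - T).PosSemidef} with hK
  set Φ : Matrix n n ℂ → ℝ × Matrix b b ℂ := fun T =>
    (((1 - T) * A).trace.re, (c : ℂ) • (1 : Matrix b b ℂ) - R T) with hΦ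
  have hRc : Continuous R := LinearMap.continuous_of_finiteDimensional R
  have hΦc : Continuous Φ := by
    refine Continuous.prodMk (Complex.continuous_re.comp ?_) (continuous_const.sub hRc)
    exact ((continuous_const.sub continuous_id).matrix_mul continuous_const).matrix_trace
  have hcomb : ∀ (S T : Matrix n n ℂ) (x y : ℝ), x + y = 1 →
      Φ (x • S + y • T) = x • Φ S + y • Φ T := fun S T x y hxy => by
    have h1 : (1 : Matrix n n ℂ) - (x • S + y • T) = x • (1 - S) + y • (1 - T) := by
      rw [smul_sub, smul_sub, sub_add_sub_comm, ← add_smul, hxy, one_smul]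
    have h2 : R (x • S + y • T) = x • R S + y • R T := by
      rw [map_add, LinearMap.map_smul_of_tower, LinearMap.map_smul_of_tower]
    refine Prod.ext ?_ ?_
    · simp only [hΦ, h1, Matrix.add_mul, Matrix.smul_mul, Matrix.trace_add, Matrix.trace_smul,
        Complex.add_re, Complex.real_smul, Complex.re_ofReal_mul, Prod.fst_add, Prod.smul_fst,
        smul_eq_mul]
    · simp only [hΦ, h2, Prod.snd_add, Prod.smul_snd, smul_sub]
      rw [sub_add_sub_comm, ← add_smul, hxy, one_smul]
  have hconvK : Convex ℝ (Φ '' K) := by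
    rintro _ ⟨S, hS, rfl⟩ _ ⟨T, hT, rfl⟩ x y hx hy hxy
    refine ⟨x • S + y • T, ⟨(hS.1.smul hx).add (hT.1.smul hy), ?_⟩, hcomb S T x y hxy⟩
    have h1 : (1 : Matrix n n ℂ) - (x • S + y • T) = x • (1 - S) + y • (1 - T) := by
      rw [smul_sub, smul_sub, sub_add_sub_comm, ← add_smul, hxy, one_smul]
    rw [h1]
    exact (hS.2.smul hx).add (hT.2.smul hy)
  have hdisj : Disjoint (Φ '' K) (Set.Iic e ×ˢ {P : Matrix b b ℂ | P.PosSemidef}) := by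
    rw [Set.disjoint_left]
    rintro _ ⟨T, hT, rfl⟩ ⟨h1, h2⟩
    exact hno ⟨T, hT.1, hT.2, h1, h2⟩
  have hconv2 : Convex ℝ (Set.Iic e ×ˢ {P : Matrix b b ℂ | P.PosSemidef}) :=
    (convex_Iic e).prod fun S hS T hT x y hx hy _ => (hS.smul hx).add (hT.smul hy)
  -- If no test met both requirements, the compact convex set of achievable pairs (error, slack)
  -- would be strictly separated from the closed convex set of acceptable pairs. The separating
  -- functional supplies the multiplier.
  obtain ⟨φ, u, v, hu, huv, hv⟩ := geometric_hahn_banach_compact_closed hconvK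
    (isCompact_tests.image hΦc) hconv2 (isClosed_Iic.prod isClosed_posSemidef) hdisj
  set l : ℝ := φ (1, 0) with hl
  set g : Matrix b b ℂ →ₗ[ℝ] ℝ := φ.toLinearMap ∘ₗ LinearMap.inr ℝ ℝ (Matrix b b ℂ) with hg
  have hφ : ∀ x P, φ (x, P) = x * l + g P := fun x P => by
    have : ((x, P) : ℝ × Matrix b b ℂ) = x • (1, 0) + (0, P) := by simp
    rw [this, map_add, map_smul]
    rfl
  have hl0 : l ≤ 0 := by
    by_contra hpos
    push Not at hpos
    have h1 := hv (min e (v / l), 0) ⟨Set.mem_Iic.mpr (min_le_left _ _), PosSemidef.zero⟩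
    rw [hφ, map_zero, add_zero] at h1
    have h2 : min e (v / l) * l ≤ v / l * l := by gcongr; exact min_le_right _ _
    rw [div_mul_cancel₀ _ hpos.ne'] at h2
    linarith
  have hgpos : ∀ P : Matrix b b ℂ, P.PosSemidef → 0 ≤ g P := fun P hP => by
    by_contra hneg
    push Not at hneg
    -- The scaling makes `g` equal to `-|v - e * l|`, just enough to push the functional to `v` or
    -- below.
    have ht : 0 ≤ |v - e * l| / (-g P) := div_nonneg (abs_nonneg _) (by linarith)
    have h1 := hv (e, (|v - e * l| / (-g P)) • P) ⟨le_refl e, hP.smul ht⟩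
    rw [hφ, map_smul, smul_eq_mul] at h1
    have h2 : |v - e * l| / (-g P) * g P = -|v - e * l| := by
      field_simp [hneg.ne]
    rw [h2] at h1
    linarith [neg_abs_le (v - e * l)]
  obtain ⟨Y, hY, hgY⟩ := exists_posSemidef_eq_trace_re g hgpos
  have hsep : ∀ T ∈ K, ((1 - T) * A).trace.re * l + (c * Y.trace.re - (R T * Y).trace.re) <
      e * l := fun T hT => by
    have h1 := hu (Φ T) ⟨T, hT, rfl⟩
    have h2 := hv (e, 0) ⟨le_refl e, PosSemidef.zero⟩
    rw [hφ, map_zero, add_zero] at h2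
    have h3 : ((c : ℂ) • (1 : Matrix b b ℂ)).IsHermitian := by
      ext i j
      by_cases hij : i = j <;> simp [hij, eq_comm]
    rw [hΦ, hφ, hgY _ (h3.sub (hR T hT.1).isHermitian), Matrix.mul_sub, Matrix.mul_smul,
      Matrix.mul_one, Matrix.trace_sub, Matrix.trace_smul, smul_eq_mul, Complex.sub_re,
      Complex.re_ofReal_mul, Matrix.trace_mul_comm Y] at h1
    linarith
  have hYtr : 0 ≤ Y.trace.re := (Complex.le_def.mp hY.trace_nonneg).1
  -- A vertical hyperplane `l = 0` is excluded by the test `T = 0`, whose slack `c • 1` is strictly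
  -- positive (Slater's condition, using `0 < c`). Otherwise `Y / (-l)` is the multiplier
  -- contradicting `h`.
  rcases hl0.eq_or_lt with h0 | hneg
  · have := hsep 0 ⟨PosSemidef.zero, by simpa using PosSemidef.one⟩
    rw [h0] at this
    simp at this
    nlinarith
  · have hm : 0 < -l := by linarith
    obtain ⟨T, hT, hT', hle⟩ := h ((-l)⁻¹ • Y) (hY.smul (inv_nonneg.mpr hm.le))
    have h1 := hsep T ⟨hT, hT'⟩
    rw [Matrix.mul_smul, Matrix.trace_smul, Matrix.trace_smul, Complex.real_smul,
      Complex.real_smul, Complex.re_ofReal_mul, Complex.re_ofReal_mul] at hle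
    have h2 := mul_le_mul_of_nonneg_left hle hm.le
    have h3 : -l * (((1 - T) * A).trace.re + (-l)⁻¹ * (R T * Y).trace.re -
        c * ((-l)⁻¹ * Y.trace.re)) =
        -l * ((1 - T) * A).trace.re + (R T * Y).trace.re - c * Y.trace.re := by
      have hne := hneg.ne
      field_simp
      ring
    rw [h3] at h2
    linarith

end Duality

/-! ### Tensor powers and partial traces -/

section TensorPower

set_option linter.unusedSectionVars false

variable {a b : Type*} [Fintype a] [DecidableEq a] [Fintype b] [DecidableEq b]

/-- The tensor power `X^{⊗ n}` of a matrix. -/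
def tpow {a : Type*} (n : ℕ) (X : Matrix a a ℂ) : Matrix (Fin n → a) (Fin n → a) ℂ :=
  Matrix.of fun p q => ∏ t, X (p t) (q t)

theorem tpow_mul (n : ℕ) (X Y : Matrix a a ℂ) : tpow n (X * Y) = tpow n X * tpow n Y := by
  ext p q
  simp only [tpow, of_apply, Matrix.mul_apply, ← Finset.prod_mul_distrib]
  rw [Finset.prod_univ_sum, Fintype.piFinset_univ]

theorem tpow_diagonal (n : ℕ) (d : a → ℂ) :
    tpow n (diagonal d) = diagonal fun p => ∏ t, d (p t) := by
  ext p q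
  by_cases h : p = q
  · subst h; simp [tpow]
  · obtain ⟨t, ht⟩ := Function.ne_iff.mp h
    rw [diagonal_apply_ne _ h]
    exact Finset.prod_eq_zero (Finset.mem_univ t) (diagonal_apply_ne _ ht)

theorem tpow_one (n : ℕ) : tpow n (1 : Matrix a a ℂ) = 1 := by
  rw [← diagonal_one, tpow_diagonal]
  simp

theorem tpow_conjTranspose (n : ℕ) (X : Matrix a a ℂ) : tpow n Xᴴ = (tpow n X)ᴴ := by
  ext p q
  simp [tpow]

theorem trace_tpow (n : ℕ) (X : Matrix a a ℂ) : (tpow n X).trace = X.trace ^ n := by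
  simp only [Matrix.trace, diag_apply, tpow, of_apply]
  have h := Finset.prod_univ_sum (fun _ : Fin n => (Finset.univ : Finset a)) fun _ k => X k k
  rw [Fintype.piFinset_univ] at h
  rw [← h, Finset.prod_const, Finset.card_univ, Fintype.card_fin]

theorem Diagonalizes.tpow {U : Matrix a a ℂ} {d : a → ℝ} {A : Matrix a a ℂ}
    (h : Diagonalizes U d A) (n : ℕ) :
    Diagonalizes (tpow n U) (fun p => ∏ t, d (p t)) (tpow n A) := by
  refine ⟨?_, ?_⟩
  · rw [← tpow_conjTranspose, ← tpow_mul, h.unitary, tpow_one]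
  · conv_lhs => rw [h.eq]
    rw [tpow_mul, tpow_mul, tpow_conjTranspose, tpow_diagonal]
    simp

theorem posSemidef_tpow {A : Matrix a a ℂ} (hA : A.PosSemidef) (n : ℕ) :
    (tpow n A).PosSemidef := by
  obtain ⟨U, d, h⟩ := exists_diagonalizes hA.isHermitian
  exact (h.tpow n).posSemidef fun p => Finset.prod_nonneg fun t _ => h.nonneg hA _

/-- A function on the nonnegative reals that preserves products. -/
structure IsMulOnNonneg (f : ℝ → ℝ) : Prop where
  map_one : f 1 = 1
  map_mul : ∀ x y, 0 ≤ x → 0 ≤ y → f (x * y) = f x * f y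

theorem isMulOnNonneg_rpow (s : ℝ) : IsMulOnNonneg fun x => x ^ s :=
  ⟨Real.one_rpow s, fun _ _ hx hy => Real.mul_rpow hx hy⟩

theorem isMulOnNonneg_sqrt : IsMulOnNonneg Real.sqrt :=
  ⟨Real.sqrt_one, fun _ y hx _ => Real.sqrt_mul hx y⟩

theorem IsMulOnNonneg.map_prod {f : ℝ → ℝ} (hf : IsMulOnNonneg f) {ι : Type*} (s : Finset ι)
    (g : ι → ℝ) (hg : ∀ i, 0 ≤ g i) : f (∏ i ∈ s, g i) = ∏ i ∈ s, f (g i) := by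
  classical
  induction s using Finset.induction_on with
  | empty => simpa using hf.map_one
  | insert i s hi ih =>
    rw [Finset.prod_insert hi, Finset.prod_insert hi,
      hf.map_mul _ _ (hg i) (Finset.prod_nonneg fun j _ => hg j), ih]

theorem cfc_tpow {A : Matrix a a ℂ} (hA : A.PosSemidef) {f : ℝ → ℝ} (hf : IsMulOnNonneg f)
    (n : ℕ) : cfc f (tpow n A) = tpow n (cfc f A) := by
  obtain ⟨U, d, h⟩ := exists_diagonalizes hA.isHermitian
  exact ((h.tpow n).cfc f).ext_of_eq ((h.cfc f).tpow n)
    fun p => hf.map_prod _ _ fun t => h.nonneg hA _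

/-- The tensor power of a bipartite matrix, with the systems grouped as `A^n B^n`. -/
def jointPow {a b : Type*} (n : ℕ) (X : Matrix (a × b) (a × b) ℂ) :
    Matrix ((Fin n → a) × (Fin n → b)) ((Fin n → a) × (Fin n → b)) ℂ :=
  (tpow n X).submatrix (Equiv.arrowProdEquivProdArrow (Fin n) (fun _ => a) fun _ => b).symm
    (Equiv.arrowProdEquivProdArrow (Fin n) (fun _ => a) fun _ => b).symm

theorem jointPow_apply (n : ℕ) (X : Matrix (a × b) (a × b) ℂ)
    (p q : (Fin n → a) × (Fin n → b)) :
    jointPow n X p q = ∏ t, X (p.1 t, p.2 t) (q.1 t, q.2 t) := rfl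

theorem jointPow_mul (n : ℕ) (X Y : Matrix (a × b) (a × b) ℂ) :
    jointPow n (X * Y) = jointPow n X * jointPow n Y := by
  rw [jointPow, tpow_mul, jointPow, jointPow, submatrix_mul_equiv]

theorem jointPow_kronecker (n : ℕ) (X : Matrix a a ℂ) (Y : Matrix b b ℂ) :
    jointPow n (X ⊗ₖ Y) = tpow n X ⊗ₖ tpow n Y := by
  ext p q
  simp [jointPow_apply, tpow, Finset.prod_mul_distrib]

theorem posSemidef_jointPow {A : Matrix (a × b) (a × b) ℂ} (hA : A.PosSemidef) (n : ℕ) :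
    (jointPow n A).PosSemidef := (posSemidef_tpow hA n).submatrix _

theorem cfc_jointPow {A : Matrix (a × b) (a × b) ℂ} (hA : A.PosSemidef) {f : ℝ → ℝ}
    (hf : IsMulOnNonneg f) (n : ℕ) : cfc f (jointPow n A) = jointPow n (cfc f A) := by
  rw [jointPow, cfc_submatrix (posSemidef_tpow hA n).isHermitian, cfc_tpow hA hf]
  rfl

/-- The partial trace over the first system. -/
def traceLeft {a b : Type*} [Fintype a] :
    Matrix (a × b) (a × b) ℂ →ₗ[ℂ] Matrix b b ℂ where
  toFun X := Matrix.of fun k l => ∑ i, X (i, k) (i, l)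
  map_add' X Y := by
    ext k l
    simp [Finset.sum_add_distrib]
  map_smul' c X := by
    ext k l
    simp [Finset.mul_sum]

theorem traceLeft_apply (X : Matrix (a × b) (a × b) ℂ) (k l : b) :
    traceLeft X k l = ∑ i, X (i, k) (i, l) := rfl

theorem posSemidef_traceLeft {X : Matrix (a × b) (a × b) ℂ} (hX : X.PosSemidef) :
    (traceLeft X).PosSemidef := by
  have : traceLeft X = ∑ i, X.submatrix (fun k => (i, k)) (fun k => (i, k)) := by
    ext k l
    simp [traceLeft_apply, Matrix.sum_apply]
  rw [this]
  exact posSemidef_sum _ fun i _ => hX.submatrix _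

theorem trace_traceLeft_mul (X : Matrix (a × b) (a × b) ℂ) (Y : Matrix b b ℂ) :
    (traceLeft X * Y).trace = (X * ((1 : Matrix a a ℂ) ⊗ₖ Y)).trace := by
  have h : ∀ i k, ∑ q, X (i, k) q * ((1 : Matrix a a ℂ) ⊗ₖ Y) q (i, k) =
      ∑ l, X (i, k) (i, l) * Y l k := fun i k => by
    rw [Fintype.sum_prod_type, Finset.sum_eq_single i]
    · simp
    · intro j _ hj
      simp [Matrix.one_apply_ne hj]
    · simp
  have e : (X * ((1 : Matrix a a ℂ) ⊗ₖ Y)).trace = ∑ i, ∑ k, ∑ l, X (i, k) (i, l) * Y l k := by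
    simp only [Matrix.trace, diag_apply, Matrix.mul_apply]
    rw [Fintype.sum_prod_type]
    exact Finset.sum_congr rfl fun i _ => Finset.sum_congr rfl fun k _ => h i k
  rw [e, Finset.sum_comm]
  simp only [Matrix.trace, diag_apply, Matrix.mul_apply, traceLeft_apply, Finset.sum_mul]
  exact Finset.sum_congr rfl fun k _ => Finset.sum_comm

theorem traceLeft_jointPow (n : ℕ) (X : Matrix (a × b) (a × b) ℂ) :
    traceLeft (jointPow n X) = tpow n (traceLeft X) := by
  ext k l
  simp only [traceLeft_apply, jointPow_apply, tpow, of_apply]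
  rw [Finset.prod_univ_sum, Fintype.piFinset_univ]

/-- The compression `(S ⊗ 1) X (S ⊗ 1)`. -/
def compress (S : Matrix a a ℂ) (X : Matrix (a × b) (a × b) ℂ) : Matrix (a × b) (a × b) ℂ :=
  (S ⊗ₖ (1 : Matrix b b ℂ)) * X * (S ⊗ₖ (1 : Matrix b b ℂ))

theorem posSemidef_compress {S : Matrix a a ℂ} (hS : S.IsHermitian)
    {X : Matrix (a × b) (a × b) ℂ} (hX : X.PosSemidef) : (compress S X).PosSemidef := by
  have h : (S ⊗ₖ (1 : Matrix b b ℂ))ᴴ = S ⊗ₖ (1 : Matrix b b ℂ) := by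
    rw [conjTranspose_kronecker, hS.eq, conjTranspose_one]
  have := hX.mul_mul_conjTranspose_same (S ⊗ₖ (1 : Matrix b b ℂ))
  rwa [h] at this

theorem trace_compress_mul (S : Matrix a a ℂ) (X Z : Matrix (a × b) (a × b) ℂ) :
    (compress S X * Z).trace = (X * compress S Z).trace := by
  rw [compress, compress, Matrix.mul_assoc, Matrix.mul_assoc, Matrix.trace_mul_comm,
    Matrix.mul_assoc]

theorem compress_kronecker (S X : Matrix a a ℂ) (Y : Matrix b b ℂ) :
    compress S (X ⊗ₖ Y) = (S * X * S) ⊗ₖ Y := by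
  rw [compress, ← mul_kronecker_mul, ← mul_kronecker_mul, Matrix.one_mul, Matrix.mul_one]

/-- The adjoint of `X ↦ Tr_R (S ⊗ 1) X (S ⊗ 1)` is `Y ↦ S² ⊗ Y`. With `S = √ρ` a multiplier `Y`
becomes the alternative hypothesis `ρ ⊗ Y`; with `S = ρ^((1-α)/2)` the Petz trace reduces to system
`B`. -/
theorem trace_traceLeft_compress_mul (S : Matrix a a ℂ) (X : Matrix (a × b) (a × b) ℂ)
    (Y : Matrix b b ℂ) :
    (traceLeft (compress S X) * Y).trace = (X * ((S * S) ⊗ₖ Y)).trace := by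
  rw [trace_traceLeft_mul, trace_compress_mul, compress_kronecker, Matrix.mul_one]

theorem jointPow_compress (n : ℕ) (S : Matrix a a ℂ) (X : Matrix (a × b) (a × b) ℂ) :
    jointPow n (compress S X) = compress (tpow n S) (jointPow n X) := by
  rw [compress, compress, jointPow_mul, jointPow_mul, jointPow_kronecker, tpow_one]

theorem inputState_eq_compress (ρ : Matrix a a ℂ) (J : Matrix (a × b) (a × b) ℂ) :
    inputState ρ J = compress (cfc Real.sqrt ρ) J := rfl

theorem inputState_jointPow {ρ : Matrix a a ℂ} (hρ : ρ.PosSemidef) (J : Matrix (a × b) (a × b) ℂ)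
    (n : ℕ) : inputState (tpow n ρ) (jointPow n J) = jointPow n (inputState ρ J) := by
  rw [inputState_eq_compress, inputState_eq_compress, jointPow_compress,
    cfc_tpow hρ isMulOnNonneg_sqrt]

theorem posSemidef_sqrt {ρ : Matrix a a ℂ} (hρ : ρ.PosSemidef) : (cfc Real.sqrt ρ).PosSemidef :=
  posSemidef_cfc hρ fun x _ => Real.sqrt_nonneg x

theorem sqrt_mul_sqrt {ρ : Matrix a a ℂ} (hρ : ρ.PosSemidef) :
    cfc Real.sqrt ρ * cfc Real.sqrt ρ = ρ := by
  rw [cfc_mul_cfc hρ (k := fun x => x) fun x hx => Real.mul_self_sqrt hx]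
  exact cfc_eq_self_of_forall hρ fun x _ => rfl

theorem posSemidef_inputState {ρ : Matrix a a ℂ} (hρ : ρ.PosSemidef)
    {J : Matrix (a × b) (a × b) ℂ} (hJ : J.PosSemidef) : (inputState ρ J).PosSemidef :=
  posSemidef_compress (posSemidef_sqrt hρ).isHermitian hJ

/-! ### The operator in the Sibson identity -/

/-- The operator `Tr_R A^α ρ_R^(1-α)`, written in symmetric form. -/
def petzMarginal (α : ℝ) (ρ : Matrix a a ℂ) (A : Matrix (a × b) (a × b) ℂ) : Matrix b b ℂ :=
  traceLeft (compress (cfc (fun x : ℝ => x ^ ((1 - α) / 2)) ρ) (cfc (fun x : ℝ => x ^ α) A))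

variable {ρ : Matrix a a ℂ} {A : Matrix (a × b) (a × b) ℂ} {α : ℝ}

theorem posSemidef_petzMarginal (hρ : ρ.PosSemidef) (hA : A.PosSemidef) :
    (petzMarginal α ρ A).PosSemidef :=
  posSemidef_traceLeft (posSemidef_compress
    (posSemidef_cfc hρ fun _ hx => Real.rpow_nonneg hx _).isHermitian
    (posSemidef_cfc hA fun _ hx => Real.rpow_nonneg hx _))

theorem trace_rpow_mul_rpow_kronecker (hρ : ρ.PosSemidef) (hα : α < 1) {Y : Matrix b b ℂ}
    (hY : Y.PosSemidef) :
    (cfc (fun x : ℝ => x ^ α) A * cfc (fun x : ℝ => x ^ (1 - α)) (ρ ⊗ₖ Y)).trace =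
      (petzMarginal α ρ A * cfc (fun x : ℝ => x ^ (1 - α)) Y).trace := by
  rw [petzMarginal, trace_traceLeft_compress_mul,
    cfc_kronecker hρ hY (isMulOnNonneg_rpow _).map_mul]
  congr 3
  refine (cfc_mul_cfc hρ fun x hx => ?_).symm
  -- The exponents add up to `1 - α ≠ 0`, so the power law also holds at a zero eigenvalue.
  rw [← Real.rpow_add' hx (by linarith)]
  congr 1
  ring

theorem petzMarginal_jointPow (hρ : ρ.PosSemidef) (hA : A.PosSemidef) (n : ℕ) :
    petzMarginal α (tpow n ρ) (jointPow n A) = tpow n (petzMarginal α ρ A) := by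
  rw [petzMarginal, petzMarginal, cfc_tpow hρ (isMulOnNonneg_rpow _),
    cfc_jointPow hA (isMulOnNonneg_rpow _), ← jointPow_compress, traceLeft_jointPow]

theorem trace_rpow_tpow {G : Matrix b b ℂ} (hG : G.PosSemidef) (s : ℝ) (n : ℕ) :
    (cfc (fun x : ℝ => x ^ s) (tpow n G)).trace.re =
      (cfc (fun x : ℝ => x ^ s) G).trace.re ^ n := by
  obtain ⟨U, d, h⟩ := exists_diagonalizes hG.isHermitian
  rw [cfc_tpow hG (isMulOnNonneg_rpow s), trace_tpow, (h.cfc _).trace_eq, ← Complex.ofReal_pow,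
    Complex.ofReal_re, Complex.ofReal_re]

/-- One-shot achievability: a test whose type-II operator is at most `M⁻¹`. -/
theorem exists_test_of_petzMarginal (hρ : ρ.PosSemidef) (hA : A.PosSemidef) (hα : 0 < α)
    (hα' : α < 1) {M : ℝ} (hM : 0 < M) :
    ∃ T : Matrix (a × b) (a × b) ℂ, T.PosSemidef ∧ (1 - T).PosSemidef ∧
      ((1 - T) * A).trace.re ≤
        M ^ ((1 - α) / α) * (cfc (fun x : ℝ => x ^ (1 / α)) (petzMarginal α ρ A)).trace.re ∧
      (((M⁻¹ : ℝ) : ℂ) • (1 : Matrix b b ℂ) -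
        traceLeft (compress (cfc Real.sqrt ρ) T)).PosSemidef := by
  set S := cfc Real.sqrt ρ with hS
  have hSh : S.IsHermitian := (posSemidef_sqrt hρ).isHermitian
  let R : Matrix (a × b) (a × b) ℂ →ₗ[ℂ] Matrix b b ℂ :=
    traceLeft ∘ₗ LinearMap.mulRight ℂ (S ⊗ₖ (1 : Matrix b b ℂ)) ∘ₗ
      LinearMap.mulLeft ℂ (S ⊗ₖ (1 : Matrix b b ℂ))
  refine exists_constrained_test A R
    (fun T hT => posSemidef_traceLeft (posSemidef_compress hSh hT)) (inv_pos.mpr hM) fun Y hY => ?_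
  -- Audenaert's inequality against `ρ ⊗ Y`; the penalty `M⁻¹ Tr Y` is exactly what Young's
  -- inequality leaves over.
  obtain ⟨T, hT, hT', hle⟩ := exists_test_le hA (hρ.kronecker hY) hα hα'
  refine ⟨T, hT, hT', ?_⟩
  have h1 : (R T * Y).trace = (T * (ρ ⊗ₖ Y)).trace := by
    have := trace_traceLeft_compress_mul S T Y
    rwa [hS, sqrt_mul_sqrt hρ] at this
  rw [trace_rpow_mul_rpow_kronecker hρ hα' hY] at hle
  have h2 := trace_mul_rpow_le (posSemidef_petzMarginal (α := α) hρ hA) hY hα hα' hM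
  rw [h1]
  linarith

end TensorPower

/-! ### Non-signaling codes from tests -/

section Code

set_option linter.unusedSectionVars false

variable {a b : Type*} [Fintype a] [DecidableEq a] [Fintype b] [DecidableEq b]

theorem choi_ofChoi {a b : Type*} [Fintype a] [DecidableEq a]
    (J : Matrix (a × b) (a × b) ℂ) : choi (ofChoi J) = J := by
  ext p q
  simp only [choi, ofChoi, LinearMap.coe_mk, AddHom.coe_mk, of_apply]
  rw [Finset.sum_eq_single p.1, Finset.sum_eq_single q.1]
  · simp
  · intro j _ hj
    simp [hj.symm]
  · simp
  · intro i _ hi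
    simp [hi.symm]
  · simp

/-- The block-diagonal matrix with blocks indexed by pairs, equal to `P` for equal pairs and to
`Q` otherwise. -/
def pairBlock {m c : Type*} [DecidableEq m] (P Q : Matrix c c ℂ) :
    Matrix ((m × m) × c) ((m × m) × c) ℂ :=
  Matrix.of fun p q => if p.1 = q.1 then (if p.1.1 = p.1.2 then P else Q) p.2 q.2 else 0

theorem posSemidef_pairBlock {m c : Type*} [Fintype m] [DecidableEq m] [Fintype c] [DecidableEq c]
    {P Q : Matrix c c ℂ} (hP : P.PosSemidef) (hQ : Q.PosSemidef) :
    (pairBlock (m := m) P Q).PosSemidef := by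
  have h : pairBlock P Q = (diagonal fun p : m × m => if p.1 = p.2 then (1 : ℂ) else 0) ⊗ₖ P +
      (diagonal fun p : m × m => if p.1 = p.2 then (0 : ℂ) else 1) ⊗ₖ Q := by
    ext p q
    simp only [pairBlock, of_apply, Matrix.add_apply, kroneckerMap_apply, diagonal_apply]
    split_ifs <;> simp
  rw [h]
  refine PosSemidef.add (PosSemidef.kronecker (PosSemidef.diagonal fun p => ?_) hP)
    (PosSemidef.kronecker (PosSemidef.diagonal fun p => ?_) hQ) <;>
  · simp only [Pi.zero_apply]
    split_ifs <;> simp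

/-- The Choi matrix of the code that decodes correctly with weight `P` and errs with weight `Q`. -/
def codeMatrix (M : ℕ) (P Q : Matrix (a × b) (a × b) ℂ) :
    Matrix (Fin M × a × b × Fin M) (Fin M × a × b × Fin M) ℂ :=
  (pairBlock P Q).submatrix (fun p => ((p.1, p.2.2.2), (p.2.1, p.2.2.1)))
    (fun p => ((p.1, p.2.2.2), (p.2.1, p.2.2.1)))

theorem codeMatrix_apply (M : ℕ) (P Q : Matrix (a × b) (a × b) ℂ) (x x' p p' : Fin M) (i i' : a)
    (k k' : b) : codeMatrix M P Q (x, i, k, p) (x', i', k', p') =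
      if x = x' ∧ p = p' then (if x = p then P (i, k) (i', k') else Q (i, k) (i', k')) else 0 := by
  simp only [codeMatrix, pairBlock, submatrix_apply, of_apply, Prod.mk.injEq]
  split_ifs <;> rfl

theorem sum_ite_eq_add_mul {M : ℕ} (x : Fin M) (u v : ℂ) :
    ∑ p : Fin M, (if x = p then u else v) = u + (M - 1) * v := by
  have h : ∀ p : Fin M, (if x = p then u else v) = (if x = p then u - v else 0) + v := by
    intro p
    split_ifs <;> ring
  simp only [h, Finset.sum_add_distrib, Finset.sum_ite_eq, Finset.mem_univ, if_true,
    Finset.sum_const, Finset.card_univ, Fintype.card_fin, nsmul_eq_mul]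
  ring

/-- Equal `B`-marginals of `P` and `Q` hide Alice's message from Bob. Summing over Bob's guesses,
one correct and `M - 1` wrong, leaves a product with the identity, which hides Bob's input from
Alice. Trace preservation follows from the marginals `1/M`. -/
theorem isNonSignaling_codeMatrix {M : ℕ} (hM : M ≠ 0) {P Q : Matrix (a × b) (a × b) ℂ}
    (hP : P.PosSemidef) (hQ : Q.PosSemidef) (hPB : traceLeft P = (M : ℂ)⁻¹ • (1 : Matrix b b ℂ))
    (hQB : traceLeft Q = (M : ℂ)⁻¹ • (1 : Matrix b b ℂ)) {ρ : Matrix a a ℂ}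
    (hPQ : P + ((M : ℂ) - 1) • Q = ρ ⊗ₖ (1 : Matrix b b ℂ)) :
    IsNonSignaling (codeMatrix M P Q) := by
  have hsum : ∀ (x x' p p' : Fin M) (k k' : b),
      ∑ i, codeMatrix M P Q (x, i, k, p) (x', i, k', p') =
        if x = x' ∧ p = p' then (M : ℂ)⁻¹ * (1 : Matrix b b ℂ) k k' else 0 := by
    intro x x' p p' k k'
    have h1 := congr_fun (congr_fun hPB k) k'
    have h2 := congr_fun (congr_fun hQB k) k'
    rw [traceLeft_apply, Matrix.smul_apply, smul_eq_mul] at h1 h2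
    simp only [codeMatrix_apply]
    split_ifs
    · exact h1
    · exact h2
    · simp
  refine ⟨(posSemidef_pairBlock hP hQ).submatrix _, fun x x' k k' => ?_,
    ⟨Matrix.of fun p q => if p.2 = q.2 then (M : ℂ)⁻¹ * (1 : Matrix b b ℂ) p.1 q.1 else 0,
      fun x x' k k' p p' => ?_⟩,
    ⟨Matrix.of fun p q => if p.1 = q.1 then ρ p.2 q.2 else 0, fun x x' i i' k k' => ?_⟩⟩
  · rw [Finset.sum_comm]
    simp only [hsum, and_true]
    by_cases hx : x = x'
    · have : (M : ℂ) ≠ 0 := Nat.cast_ne_zero.mpr hM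
      subst hx
      simp [this]
    · simp [hx]
  · rw [hsum, of_apply, Matrix.one_apply]
    by_cases hx : x = x'
    · subst hx; simp
    · simp [hx]
  · simp only [codeMatrix_apply, and_true, of_apply]
    by_cases hx : x = x'
    · have h := congr_fun (congr_fun hPQ (i, k)) (i', k')
      simp only [Matrix.add_apply, Matrix.smul_apply, smul_eq_mul, kroneckerMap_apply] at h
      simp only [hx, if_true]
      rw [sum_ite_eq_add_mul, h]
    · simp [hx]

theorem successProb_eq {M : ℕ} (J : Matrix (Fin M × a × b × Fin M) (Fin M × a × b × Fin M) ℂ)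
    (W : Matrix a a ℂ →ₗ[ℂ] Matrix b b ℂ) :
    successProb J W = (1 / (M : ℝ)) * ∑ m : Fin M, (∑ i, ∑ j, ∑ k, ∑ l,
      J (m, i, k, m) (m, j, l, m) * choi W (i, k) (j, l)).re := by
  unfold successProb
  congr 1
  refine Finset.sum_congr rfl fun m _ => ?_
  have h := congr_fun (congr_fun (choi_ofChoi (Matrix.of fun p q : Fin M × Fin M =>
    ∑ i, ∑ j, ∑ k, ∑ l, J (p.1, i, k, p.2) (q.1, j, l, q.2) * choi W (i, k) (j, l)))
    (m, m)) (m, m)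
  simp only [of_apply] at h
  rw [← h]
  rfl

/-- The link product pairing is the trace of `Xᵀ C`. -/
theorem sum_mul_eq_trace (X C : Matrix (a × b) (a × b) ℂ) :
    ∑ i, ∑ j, ∑ k, ∑ l, X (i, k) (j, l) * C (i, k) (j, l) = (Xᵀ * C).trace := by
  simp only [Matrix.trace, diag_apply, Matrix.mul_apply, transpose_apply, Fintype.sum_prod_type]
  calc ∑ i, ∑ j, ∑ k, ∑ l, X (i, k) (j, l) * C (i, k) (j, l)
      = ∑ j, ∑ i, ∑ k, ∑ l, X (i, k) (j, l) * C (i, k) (j, l) := Finset.sum_comm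
    _ = ∑ j, ∑ i, ∑ l, ∑ k, X (i, k) (j, l) * C (i, k) (j, l) :=
        Finset.sum_congr rfl fun _ _ => Finset.sum_congr rfl fun _ _ => Finset.sum_comm
    _ = _ := Finset.sum_congr rfl fun _ _ => Finset.sum_comm

theorem successProb_codeMatrix {M : ℕ} (hM : M ≠ 0) (P Q : Matrix (a × b) (a × b) ℂ)
    (W : Matrix a a ℂ →ₗ[ℂ] Matrix b b ℂ) :
    successProb (codeMatrix M P Q) W = (Pᵀ * choi W).trace.re := by
  rw [successProb_eq, ← sum_mul_eq_trace]
  have : (M : ℝ) ≠ 0 := Nat.cast_ne_zero.mpr hM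
  simp only [codeMatrix_apply, and_self, if_true, Finset.sum_const, Finset.card_univ,
    Fintype.card_fin, nsmul_eq_mul]
  field_simp

theorem norm_apply_le_trace {n : Type*} [Fintype n] [DecidableEq n] {A : Matrix n n ℂ}
    (hA : A.PosSemidef) (p q : n) : ‖A p q‖ ≤ A.trace.re := by
  obtain ⟨U, d, h⟩ := exists_diagonalizes hA.isHermitian
  have hd := h.nonneg hA
  have hU : U ∈ unitaryGroup n ℂ := mem_unitaryGroup_iff.mpr h.unitary'
  rw [h.trace_eq, Complex.ofReal_re]
  have : A p q = ∑ i, U p i * d i * star (U q i) := by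
    conv_lhs => rw [h.eq, Matrix.mul_apply]
    simp [mul_diagonal]
  rw [this]
  refine (norm_sum_le _ _).trans (Finset.sum_le_sum fun i _ => ?_)
  rw [norm_mul, norm_mul, norm_star, Complex.norm_real, Real.norm_of_nonneg (hd i)]
  have h1 := entry_norm_bound_of_unitary hU p i
  have h2 := entry_norm_bound_of_unitary hU q i
  calc ‖U p i‖ * d i * ‖U q i‖ ≤ 1 * d i * 1 := by
        gcongr
        · exact mul_nonneg (by norm_num) (hd i)
        · exact hd i
    _ = d i := by ring

/-- A real `sSup` carries information only for bounded sets. A crude bound is enough: each entry of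
`J` is at most its trace, `M * card b`. -/
theorem bddAbove_successProb (M : ℕ) (W : Matrix a a ℂ →ₗ[ℂ] Matrix b b ℂ) :
    BddAbove {s : ℝ | ∃ J : Matrix (Fin M × a × b × Fin M) (Fin M × a × b × Fin M) ℂ,
      IsNonSignaling J ∧ s = successProb J W} := by
  refine ⟨(1 / (M : ℝ)) * ∑ m : Fin M, ∑ i, ∑ j, ∑ k, ∑ l,
    (M * Fintype.card b : ℝ) * ‖choi W (i, k) (j, l)‖, ?_⟩
  rintro _ ⟨J, hJ, rfl⟩
  have htr : J.trace.re = M * Fintype.card b := by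
    have : J.trace = ∑ x, ∑ k, ∑ i, ∑ p, J (x, i, k, p) (x, i, k, p) := by
      simp only [Matrix.trace, diag_apply, Fintype.sum_prod_type]
      exact Finset.sum_congr rfl fun _ _ => Finset.sum_comm
    rw [this]
    simp [hJ.tracePreserving]
  rw [successProb_eq]
  refine mul_le_mul_of_nonneg_left (Finset.sum_le_sum fun m _ => ?_) (by positivity)
  simp only [Complex.re_sum]
  refine Finset.sum_le_sum fun i _ => Finset.sum_le_sum fun j _ => Finset.sum_le_sum fun k _ =>
    Finset.sum_le_sum fun l _ => ?_
  refine (Complex.re_le_norm _).trans ?_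
  rw [norm_mul, ← htr]
  exact mul_le_mul_of_nonneg_right (norm_apply_le_trace hJ.posSemidef _ _) (norm_nonneg _)

theorem nsError_le_of_codeMatrix {M : ℕ} (hM : M ≠ 0) {P Q : Matrix (a × b) (a × b) ℂ}
    (hPQ : IsNonSignaling (codeMatrix M P Q)) (W : Matrix a a ℂ →ₗ[ℂ] Matrix b b ℂ) :
    nsError M W ≤ 1 - (Pᵀ * choi W).trace.re := by
  refine sub_le_sub_left ?_ 1
  rw [← successProb_codeMatrix hM P Q W]
  exact le_csSup (bddAbove_successProb M W) ⟨_, hPQ, rfl⟩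

end Code

/-! ### Activation by a noiseless bit and the one-shot bound -/

section Activation

set_option linter.unusedSectionVars false

variable {a b : Type*} [Fintype a] [DecidableEq a] [Fintype b] [DecidableEq b]

theorem posSemidef_ofReal_smul {n : Type*} {A : Matrix n n ℂ} (hA : A.PosSemidef) {c : ℝ}
    (hc : 0 ≤ c) : ((c : ℂ) • A).PosSemidef := hA.smul (Complex.zero_le_real.mpr hc)

/-- The test on `A B` with an additional classical bit on each side, equal to `P` when the bits
agree and to `Q` otherwise. -/
def bitBlock (P Q : Matrix (a × b) (a × b) ℂ) :
    Matrix ((a × Fin 2) × (b × Fin 2)) ((a × Fin 2) × (b × Fin 2)) ℂ :=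
  (pairBlock P Q).submatrix (fun p => ((p.1.2, p.2.2), (p.1.1, p.2.1)))
    (fun p => ((p.1.2, p.2.2), (p.1.1, p.2.1)))

theorem bitBlock_apply (P Q : Matrix (a × b) (a × b) ℂ) (i i' : a) (k k' : b)
    (x x' y y' : Fin 2) : bitBlock P Q ((i, x), (k, y)) ((i', x'), (k', y')) =
      if x = x' ∧ y = y' then (if x = y then P (i, k) (i', k') else Q (i, k) (i', k')) else 0 := by
  simp only [bitBlock, pairBlock, submatrix_apply, of_apply, Prod.mk.injEq]
  split_ifs <;> rfl

theorem posSemidef_bitBlock {P Q : Matrix (a × b) (a × b) ℂ} (hP : P.PosSemidef)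
    (hQ : Q.PosSemidef) : (bitBlock P Q).PosSemidef := (posSemidef_pairBlock hP hQ).submatrix _

theorem traceLeft_bitBlock (P Q : Matrix (a × b) (a × b) ℂ) :
    traceLeft (bitBlock P Q) = (traceLeft P + traceLeft Q) ⊗ₖ (1 : Matrix (Fin 2) (Fin 2) ℂ) := by
  ext ⟨k, y⟩ ⟨k', y'⟩
  simp only [traceLeft_apply, Fintype.sum_prod_type, bitBlock_apply, kroneckerMap_apply,
    Matrix.add_apply, Fin.sum_univ_two]
  rw [Finset.sum_add_distrib]
  fin_cases y <;> fin_cases y' <;> simp [add_comm]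

theorem choi_bitChannel (x x' y y' : Fin 2) : choi bitChannel (x, y) (x', y') =
    if x = x' ∧ y = x ∧ y' = x then 1 else 0 := by
  simp only [choi, bitChannel, of_apply, LinearMap.coe_mk, AddHom.coe_mk, diagonal_apply,
    diag_apply, single_apply]
  fin_cases x <;> fin_cases x' <;> fin_cases y <;> fin_cases y' <;> simp

theorem choi_tensor {a' b' : Type*} [Fintype a'] [DecidableEq a']
    (V : Matrix a a ℂ →ₗ[ℂ] Matrix b b ℂ)
    (W : Matrix a' a' ℂ →ₗ[ℂ] Matrix b' b' ℂ) (i j : a) (k l : b) (x x' : a') (y y' : b') :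
    choi (tensor V W) ((i, x), (k, y)) ((j, x'), (l, y')) =
      choi V (i, k) (j, l) * choi W (x, y) (x', y') := by
  rw [tensor, choi_ofChoi, of_apply]

theorem choi_tensorPow (n : ℕ) (W : Matrix a a ℂ →ₗ[ℂ] Matrix b b ℂ) :
    choi (tensorPow n W) = jointPow n (choi W) := choi_ofChoi _

/-- The noiseless bit always arrives unchanged, so the block `Q` for disagreeing bits is never seen;
it can be used freely to adjust marginals. The factor 2 counts the values of the bit. -/
theorem trace_bitBlock_mul_choi (P Q : Matrix (a × b) (a × b) ℂ)
    (V : Matrix a a ℂ →ₗ[ℂ] Matrix b b ℂ) :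
    ((bitBlock P Q)ᵀ * choi (tensor V bitChannel)).trace = 2 * (Pᵀ * choi V).trace := by
  rw [← sum_mul_eq_trace, ← sum_mul_eq_trace]
  simp only [Fintype.sum_prod_type, bitBlock_apply, choi_tensor, choi_bitChannel,
    Fin.sum_univ_two]
  simp [Finset.sum_add_distrib, two_mul]

theorem traceLeft_kronecker (ρ : Matrix a a ℂ) (X : Matrix b b ℂ) :
    traceLeft (ρ ⊗ₖ X) = ρ.trace • X := by
  ext k l
  simp [traceLeft_apply, Matrix.trace, Finset.sum_mul]

/-- A meta-converse test gives a code for the channel activated by one noiseless bit. -/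
theorem nsError_tensor_bitChannel_le (V : Matrix a a ℂ →ₗ[ℂ] Matrix b b ℂ) {M : ℕ} (hM : 2 ≤ M)
    {ρ : Matrix a a ℂ} (hρ : IsState ρ) {Λ : Matrix (a × b) (a × b) ℂ} (hΛ : Λ.PosSemidef)
    (hρΛ : (ρ ⊗ₖ (1 : Matrix b b ℂ) - Λ).PosSemidef)
    (hB : ((((M : ℝ)⁻¹ : ℝ) : ℂ) • (1 : Matrix b b ℂ) - traceLeft Λ).PosSemidef) :
    nsError M (tensor V bitChannel) ≤ 1 - (Λᵀ * choi V).trace.re := by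
  have hM2 : (2 : ℝ) ≤ M := by exact_mod_cast hM
  have hM0 : M ≠ 0 := by omega
  have hMc : (M : ℂ) ≠ 0 := Nat.cast_ne_zero.mpr hM0
  have hM1c : (M : ℂ) - 1 ≠ 0 := by
    have : ((M - 1 : ℝ) : ℂ) ≠ 0 := Complex.ofReal_ne_zero.mpr (by linarith)
    simpa using this
  set B : Matrix b b ℂ := traceLeft Λ with hBdef
  have hBpos : B.PosSemidef := posSemidef_traceLeft hΛ
  -- Each value of the bit carries weight `h = 1/2`. The padding `N` is what `h • B` lacks to reach
  -- the required marginal `1/M`, and `d` shares the remaining weight equally among the `M - 1`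
  -- wrong guesses.
  set h : ℝ := 1 / 2 with hh
  set d : ℝ := (M - 1 : ℝ)⁻¹ with hd
  have hd0 : 0 ≤ d := inv_nonneg.mpr (by linarith)
  set N : Matrix b b ℂ := (((M : ℝ)⁻¹ : ℝ) : ℂ) • (1 : Matrix b b ℂ) - (h : ℂ) • B with hN
  have hNpos : N.PosSemidef := by
    have : N = ((((M : ℝ)⁻¹ : ℝ) : ℂ) • (1 : Matrix b b ℂ) - B) + (h : ℂ) • B := by
      ext i j
      simp [hN, hh]
      ring
    rw [this]
    exact hB.add (posSemidef_ofReal_smul hBpos (by norm_num [hh]))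
  have hNpos' : ((h : ℂ) • (1 : Matrix b b ℂ) - N).PosSemidef := by
    have : (h : ℂ) • (1 : Matrix b b ℂ) - N =
        ((h - (M : ℝ)⁻¹ : ℝ) : ℂ) • (1 : Matrix b b ℂ) + (h : ℂ) • B := by
      ext i j
      simp [hN]
      ring
    rw [this]
    refine (posSemidef_ofReal_smul PosSemidef.one ?_).add
      (posSemidef_ofReal_smul hBpos (by norm_num [hh]))
    -- Here `2 ≤ M` is essential; a single message is treated separately.
    rw [sub_nonneg, hh, one_div]
    exact inv_anti₀ (by norm_num) hM2
  have hTk : ∀ X : Matrix b b ℂ, traceLeft (ρ ⊗ₖ X) = X := fun X => by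
    rw [traceLeft_kronecker, hρ.trace_eq_one, one_smul]
  have hcode : IsNonSignaling (codeMatrix M (bitBlock ((h : ℂ) • Λ) (ρ ⊗ₖ N))
      (bitBlock ((d : ℂ) • (h : ℂ) • (ρ ⊗ₖ (1 : Matrix b b ℂ) - Λ))
        ((d : ℂ) • (ρ ⊗ₖ ((h : ℂ) • (1 : Matrix b b ℂ) - N))))) := by
    refine isNonSignaling_codeMatrix hM0
      (posSemidef_bitBlock (posSemidef_ofReal_smul hΛ (by norm_num [hh]))
        (hρ.posSemidef.kronecker hNpos))
      (posSemidef_bitBlock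
        (posSemidef_ofReal_smul (posSemidef_ofReal_smul hρΛ (by norm_num [hh])) hd0)
        (posSemidef_ofReal_smul (hρ.posSemidef.kronecker hNpos') hd0))
      (ρ := ((h : ℂ) • ρ) ⊗ₖ (1 : Matrix (Fin 2) (Fin 2) ℂ)) ?_ ?_ ?_
    · rw [traceLeft_bitBlock, map_smul, hTk, ← hBdef, hN, add_sub_cancel, smul_kronecker,
        one_kronecker_one]
      simp
    · rw [traceLeft_bitBlock, map_smul, map_smul, map_smul, map_sub, hTk, hTk, ← hBdef]
      have : (d : ℂ) • (h : ℂ) • (1 - B) + (d : ℂ) • ((h : ℂ) • (1 : Matrix b b ℂ) - N) =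
          (M : ℂ)⁻¹ • (1 : Matrix b b ℂ) := by
        ext i j
        simp [hN, hh, hd]
        field_simp
        ring
      rw [this, smul_kronecker, one_kronecker_one]
    · ext ⟨⟨i, x⟩, ⟨k, y⟩⟩ ⟨⟨j, x'⟩, ⟨l, y'⟩⟩
      have h1 : ((M : ℂ) - 1) * (d : ℂ) = 1 := by
        rw [hd]
        push_cast
        exact mul_inv_cancel₀ hM1c
      simp only [Matrix.add_apply, Matrix.smul_apply, smul_eq_mul, bitBlock_apply,
        kroneckerMap_apply, Matrix.sub_apply, Matrix.one_apply, Prod.mk.injEq]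
      by_cases hx : x = x' <;> by_cases hy : y = y'
      · subst hx hy
        simp only [and_self, if_true, and_true, mul_one]
        by_cases hxy : x = y
        · simp only [hxy, if_true]
          linear_combination
            (h : ℂ) * (ρ i j * (if k = l then 1 else 0) - Λ (i, k) (j, l)) * h1
        · simp only [hxy, if_false]
          linear_combination ρ i j * ((h : ℂ) * (if k = l then 1 else 0) - N k l) * h1
      · simp [hx, hy]
      · simp [hx, hy]
      · simp [hx, hy]
  refine (nsError_le_of_codeMatrix hM0 hcode _).trans_eq ?_
  rw [trace_bitBlock_mul_choi, transpose_smul, Matrix.smul_mul, Matrix.trace_smul, smul_eq_mul,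
    ← mul_assoc]
  congr 2
  rw [hh]
  push_cast
  ring_nf

/-- Trace preservation, in terms of the Choi matrix. -/
def IsTracePreservingChoi (C : Matrix (a × b) (a × b) ℂ) : Prop :=
  ∀ i j, ∑ k, C (i, k) (j, k) = (1 : Matrix a a ℂ) i j

theorem trace_kronecker_one_mul {C : Matrix (a × b) (a × b) ℂ} (hC : IsTracePreservingChoi C)
    (ρ : Matrix a a ℂ) : ((ρ ⊗ₖ (1 : Matrix b b ℂ)) * C).trace = ρ.trace := by
  have h := sum_mul_eq_trace (ρ ⊗ₖ (1 : Matrix b b ℂ))ᵀ C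
  rw [transpose_transpose] at h
  rw [← h]
  simp only [transpose_apply, kroneckerMap_apply, Matrix.one_apply, mul_ite, mul_one, mul_zero,
    ite_mul, zero_mul, Finset.sum_ite_eq', Finset.sum_ite_eq, Finset.mem_univ, if_true,
    ← Finset.mul_sum, hC _ _]
  rfl

theorem trace_inputState {C : Matrix (a × b) (a × b) ℂ} (hC : IsTracePreservingChoi C)
    {ρ : Matrix a a ℂ} (hρ : IsState ρ) : (inputState ρ C).trace = 1 := by
  have h := trace_compress_mul (cfc Real.sqrt ρ) C 1
  rw [Matrix.mul_one, ← one_kronecker_one, compress_kronecker, Matrix.mul_one,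
    sqrt_mul_sqrt hρ.posSemidef, Matrix.trace_mul_comm, trace_kronecker_one_mul hC,
    hρ.trace_eq_one] at h
  exact h

theorem isState_transpose {ρ : Matrix a a ℂ} (hρ : IsState ρ) : IsState ρᵀ :=
  ⟨hρ.posSemidef.transpose, by rw [trace_transpose, hρ.trace_eq_one]⟩

/-- With one message there are no wrong guesses, so `P = ρ ⊗ 1` alone is a code and it always
succeeds. -/
theorem nsError_one_nonpos {V : Matrix a a ℂ →ₗ[ℂ] Matrix b b ℂ}
    (hV : IsTracePreservingChoi (choi V)) {ρ : Matrix a a ℂ} (hρ : IsState ρ) :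
    nsError 1 V ≤ 0 := by
  have hP : (ρ ⊗ₖ (1 : Matrix b b ℂ)).PosSemidef := hρ.posSemidef.kronecker PosSemidef.one
  have hT : traceLeft (ρ ⊗ₖ (1 : Matrix b b ℂ)) = ((1 : ℕ) : ℂ)⁻¹ • (1 : Matrix b b ℂ) := by
    rw [traceLeft_kronecker, hρ.trace_eq_one]
    simp
  have h := nsError_le_of_codeMatrix one_ne_zero
    (isNonSignaling_codeMatrix (ρ := ρ) one_ne_zero hP hP hT hT (by simp)) V
  have e : (ρ ⊗ₖ (1 : Matrix b b ℂ))ᵀ = ρᵀ ⊗ₖ (1 : Matrix b b ℂ) := by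
    ext p q
    simp [Matrix.one_apply, eq_comm]
  rw [e, trace_kronecker_one_mul hV, trace_transpose, hρ.trace_eq_one] at h
  simpa using h

theorem isTracePreservingChoi_tensor_bitChannel {V : Matrix a a ℂ →ₗ[ℂ] Matrix b b ℂ}
    (hV : IsTracePreservingChoi (choi V)) :
    IsTracePreservingChoi (choi (tensor V bitChannel)) := by
  rintro ⟨i, x⟩ ⟨j, x'⟩
  simp only [Fintype.sum_prod_type, choi_tensor, choi_bitChannel, ← Finset.mul_sum]
  rw [← Finset.sum_mul, hV, ← one_kronecker_one, kroneckerMap_apply]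
  congr 1
  fin_cases x <;> fin_cases x' <;> simp

theorem isTracePreservingChoi_tensorPow {W : Matrix a a ℂ →ₗ[ℂ] Matrix b b ℂ}
    (hW : IsTracePreservingChoi (choi W)) (n : ℕ) :
    IsTracePreservingChoi (choi (tensorPow n W)) := by
  intro i j
  rw [choi_tensorPow]
  simp only [jointPow_apply]
  have h := Finset.prod_univ_sum (fun _ : Fin n => (Finset.univ : Finset b))
    fun t k => choi W (i t, k) (j t, k)
  rw [Fintype.piFinset_univ] at h
  rw [← h]
  simp only [hW _ _]
  rw [← tpow_one]
  rfl

theorem IsChannel.isTracePreservingChoi {W : Matrix a a ℂ →ₗ[ℂ] Matrix b b ℂ}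
    (hW : IsChannel W) : IsTracePreservingChoi (choi W) := by
  intro i j
  have h := hW.tracePreserving (single i j 1)
  rw [Matrix.one_apply]
  refine Eq.trans ?_ (h.trans ?_)
  · rfl
  · by_cases hij : i = j
    · subst hij; simp
    · simp [hij]

/-- The Choi matrix is the image of the unnormalized maximally entangled state `v`. The enumeration
`e` is needed because complete positivity is stated for ancillas `Fin k`. -/
theorem IsChannel.posSemidef_choi {W : Matrix a a ℂ →ₗ[ℂ] Matrix b b ℂ}
    (hW : IsChannel W) : (choi W).PosSemidef := by
  let e := Fintype.equivFin a
  let v : Fin (Fintype.card a) × a → ℂ := fun p => if p.1 = e p.2 then 1 else 0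
  have h := (hW.completelyPositive _ _ (posSemidef_vecMulVec_self_star v)).submatrix
    fun p : a × b => (e p.1, p.2)
  convert h using 1
  ext p q
  simp only [choi, ampliate, of_apply, submatrix_apply]
  suffices h : single p.1 q.1 (1 : ℂ) = Matrix.of fun i j =>
      vecMulVec v (star v) (e p.1, i) (e q.1, j) by rw [h]
  ext i j
  simp only [single_apply, of_apply, vecMulVec_apply, v, EmbeddingLike.apply_eq_iff_eq,
    Pi.star_apply]
  by_cases h1 : p.1 = i <;> by_cases h2 : q.1 = j <;> simp [h1, h2]

theorem isState_tpow {ρ : Matrix a a ℂ} (hρ : IsState ρ) (n : ℕ) : IsState (tpow n ρ) :=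
  ⟨posSemidef_tpow hρ.posSemidef n, by rw [trace_tpow, hρ.trace_eq_one, one_pow]⟩

theorem nsError_one_tensor_bitChannel_nonpos {V : Matrix a a ℂ →ₗ[ℂ] Matrix b b ℂ}
    (hV : IsTracePreservingChoi (choi V)) {ρ : Matrix a a ℂ} (hρ : IsState ρ) :
    nsError 1 (tensor V bitChannel) ≤ 0 := by
  have hσ : IsState (ρ ⊗ₖ (single 0 0 1 : Matrix (Fin 2) (Fin 2) ℂ)) := by
    refine ⟨hρ.posSemidef.kronecker ?_, ?_⟩
    · rw [← diagonal_single]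
      refine PosSemidef.diagonal fun i => ?_
      by_cases hi : i = 0 <;> simp [hi]
    · rw [trace_kronecker, hρ.trace_eq_one]
      simp
  exact nsError_one_nonpos (isTracePreservingChoi_tensor_bitChannel hV) hσ

theorem nsError_tensor_bitChannel_le_one {V : Matrix a a ℂ →ₗ[ℂ] Matrix b b ℂ}
    (hV : IsTracePreservingChoi (choi V)) {ρ : Matrix a a ℂ} (hρ : IsState ρ) {M : ℕ}
    (hM : 1 ≤ M) : nsError M (tensor V bitChannel) ≤ 1 := by
  rcases hM.eq_or_lt with rfl | hM
  · exact (nsError_one_tensor_bitChannel_nonpos hV hρ).trans zero_le_one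
  · have h1 := posSemidef_ofReal_smul (PosSemidef.one (n := b) (R := ℂ)) (c := (M : ℝ)⁻¹)
      (by positivity)
    have h := nsError_tensor_bitChannel_le V (M := M) hM hρ (Λ := 0) PosSemidef.zero
      (by simpa using hρ.posSemidef.kronecker PosSemidef.one) (by simpa using h1)
    simpa using h

/-- One-shot bound on the activated non-signaling error. -/
theorem nsError_tensor_bitChannel_le_petzMarginal {V : Matrix a a ℂ →ₗ[ℂ] Matrix b b ℂ}
    (hV : IsTracePreservingChoi (choi V)) (hV' : (choi V).PosSemidef) {ρ : Matrix a a ℂ}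
    (hρ : IsState ρ) {M : ℕ} (hM : 1 ≤ M) {α : ℝ} (hα : 0 < α) (hα' : α < 1) :
    nsError M (tensor V bitChannel) ≤ (M : ℝ) ^ ((1 - α) / α) * (cfc (fun x : ℝ => x ^ (1 / α))
      (petzMarginal α ρ (inputState ρ (choi V)))).trace.re := by
  have hA := posSemidef_inputState hρ.posSemidef hV'
  rcases hM.eq_or_lt with rfl | hM
  · refine (nsError_one_tensor_bitChannel_nonpos hV hρ).trans (mul_nonneg (by positivity) ?_)
    exact (Complex.le_def.mp (posSemidef_cfc (posSemidef_petzMarginal hρ.posSemidef hA)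
      fun _ hx => Real.rpow_nonneg hx _).trace_nonneg).1
  obtain ⟨T, hT, hT', herr, hcon⟩ := exists_test_of_petzMarginal (α := α) hρ.posSemidef hA hα hα'
    (M := (M : ℝ)) (by positivity)
  set S := cfc Real.sqrt ρ with hS
  have hSh : S.IsHermitian := (posSemidef_sqrt hρ.posSemidef).isHermitian
  have hc : compress S (1 : Matrix (a × b) (a × b) ℂ) = ρ ⊗ₖ (1 : Matrix b b ℂ) := by
    rw [← one_kronecker_one, compress_kronecker, Matrix.mul_one, hS, sqrt_mul_sqrt hρ.posSemidef]
  have hsub : ρ ⊗ₖ (1 : Matrix b b ℂ) - compress S T = compress S (1 - T) := by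
    rw [← hc, compress, compress, compress, Matrix.mul_sub, Matrix.sub_mul]
  have e : (ρᵀ ⊗ₖ (1 : Matrix b b ℂ)) = (ρ ⊗ₖ (1 : Matrix b b ℂ))ᵀ := by
    ext p q
    simp [Matrix.one_apply, eq_comm]
  -- The link product pairs a code with the Choi matrix through a transpose, so the code is built
  -- from the transposed test and the input state `ρᵀ`.
  refine (nsError_tensor_bitChannel_le V hM (isState_transpose hρ)
    (Λ := (compress S T)ᵀ) (posSemidef_compress hSh hT).transpose ?_ ?_).trans ?_
  · rw [e, ← transpose_sub, hsub]
    exact (posSemidef_compress hSh hT').transpose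
  · have := hcon.transpose
    rwa [transpose_sub, transpose_smul, transpose_one] at this
  · refine le_trans (le_of_eq ?_) herr
    rw [transpose_transpose, trace_compress_mul, Matrix.sub_mul, Matrix.one_mul, Matrix.trace_sub,
      trace_inputState hV hρ, Complex.sub_re, Complex.one_re]
    rfl

end Activation

/-! ### The activated exponent -/

section Exponent

variable {a b : Type*} [Fintype a] [DecidableEq a] [Fintype b] [DecidableEq b]

/-- `Tr G^(1/α)` for `G = Tr_R A^α ρ_R^(1-α)`; its `-log` is the optimized Rényi information, up to
the factor `(1-α)/α`. -/
def petzTrace (α : ℝ) (ρ : Matrix a a ℂ) (A : Matrix (a × b) (a × b) ℂ) : ℝ :=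
  (cfc (fun x : ℝ => x ^ (1 / α)) (petzMarginal α ρ A)).trace.re

theorem petzTrace_nonneg (α : ℝ) {ρ : Matrix a a ℂ} {A : Matrix (a × b) (a × b) ℂ}
    (hρ : ρ.PosSemidef) (hA : A.PosSemidef) : 0 ≤ petzTrace α ρ A :=
  (Complex.le_def.mp (posSemidef_cfc (posSemidef_petzMarginal hρ hA)
    fun _ hx => Real.rpow_nonneg hx _).trace_nonneg).1

theorem petzTrace_jointPow (α : ℝ) {ρ : Matrix a a ℂ} {A : Matrix (a × b) (a × b) ℂ}
    (hρ : ρ.PosSemidef) (hA : A.PosSemidef) (n : ℕ) :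
    petzTrace α (tpow n ρ) (jointPow n A) = petzTrace α ρ A ^ n := by
  rw [petzTrace, petzMarginal_jointPow hρ hA, trace_rpow_tpow (posSemidef_petzMarginal hρ hA)]
  rfl

/-- The optimal state in the Sibson identity. -/
theorem exists_state_petzRenyi_eq {α : ℝ} (hα : 0 < α) (hα' : α < 1) {ρ : Matrix a a ℂ}
    {A : Matrix (a × b) (a × b) ℂ} (hρ : ρ.PosSemidef) (hA : A.PosSemidef)
    (hg : 0 < petzTrace α ρ A) : ∃ σ : Matrix b b ℂ, IsState σ ∧
      petzRenyi α A (ρ ⊗ₖ σ) =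
        (((α - 1)⁻¹ * (α * Real.log (petzTrace α ρ A)) : ℝ) : EReal) := by
  have hG : (petzMarginal α ρ A).PosSemidef := posSemidef_petzMarginal hρ hA
  set g := petzTrace α ρ A with hgdef
  obtain ⟨U, d, h⟩ := exists_diagonalizes hG.isHermitian
  have hd := h.nonneg hG
  have hgd : g = ∑ i, d i ^ (1 / α) := trace_cfc_eq h _
  -- Sibson's choice `σ = G^(1/α) / g` is diagonal in the eigenbasis of `G`, so the trace is a
  -- scalar computation with value `g ^ α`.
  have hσ := (h.cfc fun x => x ^ (1 / α)).smul g⁻¹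
  set σ := ((g⁻¹ : ℝ) : ℂ) • cfc (fun x : ℝ => x ^ (1 / α)) (petzMarginal α ρ A)
  have hσpos : σ.PosSemidef := hσ.posSemidef fun i =>
    mul_nonneg (inv_nonneg.mpr hg.le) (Real.rpow_nonneg (hd i) _)
  refine ⟨σ, ⟨hσpos, ?_⟩, ?_⟩
  · rw [hσ.trace_eq, ← Finset.mul_sum]
    simp only [Function.comp_apply]
    rw [← hgd, inv_mul_cancel₀ hg.ne', Complex.ofReal_one]
  have htr : (cfc (fun x : ℝ => x ^ α) A *
      cfc (fun x : ℝ => x ^ (1 - α)) (ρ ⊗ₖ σ)).trace.re = g ^ α := by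
    rw [trace_rpow_mul_rpow_kronecker hρ hα' hσpos, (h.mul (hσ.cfc _)).trace_eq,
      Complex.ofReal_re]
    have hterm : ∀ i, d i * (g⁻¹ * d i ^ (1 / α)) ^ (1 - α) =
        (g⁻¹) ^ (1 - α) * d i ^ (1 / α) := fun i => by
      have h1 : 1 + 1 / α * (1 - α) = 1 / α := by
        field_simp
        ring
      rw [Real.mul_rpow (inv_nonneg.mpr hg.le) (Real.rpow_nonneg (hd i) _),
        ← Real.rpow_mul (hd i), mul_left_comm]
      congr 1
      conv_lhs => enter [1]; rw [← Real.rpow_one (d i)]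
      rw [← Real.rpow_add' (hd i) (by rw [h1]; positivity), h1]
    simp only [Function.comp_apply, hterm]
    rw [← Finset.mul_sum, ← hgd, Real.inv_rpow hg.le, ← Real.rpow_neg hg.le]
    conv_lhs => enter [2]; rw [← Real.rpow_one g]
    rw [← Real.rpow_add hg]
    congr 1
    ring
  rw [petzRenyi, if_neg hα'.ne, htr, ENNReal.log_ofReal_of_pos (Real.rpow_pos_of_pos hg _),
    Real.log_rpow hg, ← EReal.coe_mul]

theorem ansExponent_nonneg {W : Matrix a a ℂ →ₗ[ℂ] Matrix b b ℂ} (hW : IsChannel W)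
    {ρ : Matrix a a ℂ} (hρ : IsState ρ) (r : ℝ) : 0 ≤ ansExponent W r := by
  refine le_liminf_of_le (by isBoundedDefault) (Eventually.of_forall fun n => ?_)
  have hM : 1 ≤ ⌈Real.exp (n * r)⌉₊ := Nat.one_le_ceil_iff.mpr (Real.exp_pos _)
  have h := nsError_tensor_bitChannel_le_one
    (isTracePreservingChoi_tensorPow hW.isTracePreservingChoi n) (isState_tpow hρ n) hM
  refine mul_nonneg (EReal.coe_nonneg.mpr (by positivity)) ?_
  rw [EReal.neg_nonneg, ENNReal.log_le_zero_iff]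
  exact ENNReal.ofReal_le_one.mpr h

theorem nsError_le_petzTrace {W : Matrix a a ℂ →ₗ[ℂ] Matrix b b ℂ} (hW : IsChannel W)
    {ρ : Matrix a a ℂ} (hρ : IsState ρ) {α : ℝ} (hα : 0 < α) (hα' : α < 1) (n : ℕ) {M : ℕ}
    (hM : 1 ≤ M) : nsError M (tensor (tensorPow n W) bitChannel) ≤
      (M : ℝ) ^ ((1 - α) / α) * petzTrace α ρ (inputState ρ (choi W)) ^ n := by
  have hC := hW.posSemidef_choi
  have h := nsError_tensor_bitChannel_le_petzMarginal
    (isTracePreservingChoi_tensorPow hW.isTracePreservingChoi n)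
    (by rw [choi_tensorPow]; exact posSemidef_jointPow hC n) (isState_tpow hρ n) hM hα hα'
  rw [choi_tensorPow, inputState_jointPow hρ.posSemidef] at h
  rw [← petzTrace_jointPow α hρ.posSemidef (posSemidef_inputState hρ.posSemidef hC) n]
  exact h

/-- Treating `g = 0` apart avoids both a proof that `g` is positive and the default value `Real.log
0 = 0`. The restriction to `n ≥ 1` matters, since `0 ^ 0 = 1`. -/
theorem ansExponent_eq_top {W : Matrix a a ℂ →ₗ[ℂ] Matrix b b ℂ} (hW : IsChannel W)
    {ρ : Matrix a a ℂ} (hρ : IsState ρ) {α : ℝ} (hα : 0 < α) (hα' : α < 1) (r : ℝ)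
    (hg : petzTrace α ρ (inputState ρ (choi W)) = 0) : ansExponent W r = ⊤ := by
  refine top_le_iff.mp (le_liminf_of_le (by isBoundedDefault) ?_)
  filter_upwards [eventually_ge_atTop 1] with n hn
  have hM : 1 ≤ ⌈Real.exp (n * r)⌉₊ := Nat.one_le_ceil_iff.mpr (Real.exp_pos _)
  have h := nsError_le_petzTrace hW hρ hα hα' n hM
  rw [hg, zero_pow (by omega), mul_zero] at h
  rw [ENNReal.ofReal_of_nonpos h, ENNReal.log_zero, EReal.neg_bot, EReal.coe_mul_top_of_pos]
  have : (0 : ℝ) < n := by exact_mod_cast hn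
  positivity

theorem le_ansExponent {W : Matrix a a ℂ →ₗ[ℂ] Matrix b b ℂ} (hW : IsChannel W)
    {ρ : Matrix a a ℂ} (hρ : IsState ρ) {α : ℝ} (hα : 0 < α) (hα' : α < 1) {r : ℝ} (hr : 0 ≤ r)
    (hg : 0 < petzTrace α ρ (inputState ρ (choi W))) :
    ((-((1 - α) / α * r + Real.log (petzTrace α ρ (inputState ρ (choi W)))) : ℝ) : EReal) ≤
      ansExponent W r := by
  set g := petzTrace α ρ (inputState ρ (choi W))
  set s := (1 - α) / α with hs
  have hs0 : 0 ≤ s := div_nonneg (by linarith) hα.le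
  -- The correction `s * log 2 / n` is the price of rounding `e^(nr)` up to an integer.
  have hlim : Tendsto (fun n : ℕ => ((-(s * r + Real.log g) - s * Real.log 2 / n : ℝ) : EReal))
      atTop (nhds ((-(s * r + Real.log g) : ℝ) : EReal)) := by
    refine (continuous_coe_real_ereal.tendsto _).comp ?_
    simpa using (tendsto_const_nhds (x := -(s * r + Real.log g))).sub
      (tendsto_const_div_atTop_nhds_zero_nat (s * Real.log 2))
  rw [← hlim.liminf_eq]
  refine liminf_le_liminf ?_
  filter_upwards [eventually_ge_atTop 1] with n hn
  have hn' : (0 : ℝ) < n := by exact_mod_cast hn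
  have hM : 1 ≤ ⌈Real.exp (n * r)⌉₊ := Nat.one_le_ceil_iff.mpr (Real.exp_pos _)
  have hexp : 1 ≤ Real.exp (n * r) := Real.one_le_exp (by positivity)
  -- Since `r ≥ 0`, the 1 added by rounding up is at most `e^(nr)`.
  have hM2 : (⌈Real.exp (n * r)⌉₊ : ℝ) ≤ 2 * Real.exp (n * r) := by
    have := Nat.ceil_lt_add_one (Real.exp_pos (n * r)).le
    linarith
  have hbound : nsError ⌈Real.exp (n * r)⌉₊ (tensor (tensorPow n W) bitChannel) ≤
      (2 * Real.exp (n * r)) ^ s * g ^ n :=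
    (nsError_le_petzTrace hW hρ hα hα' n hM).trans (by gcongr)
  have hlog : ENNReal.log (ENNReal.ofReal
      (nsError ⌈Real.exp (n * r)⌉₊ (tensor (tensorPow n W) bitChannel))) ≤
      ((s * (Real.log 2 + n * r) + n * Real.log g : ℝ) : EReal) := by
    refine (ENNReal.log_monotone (ENNReal.ofReal_le_ofReal hbound)).trans_eq ?_
    rw [ENNReal.log_ofReal_of_pos (by positivity), Real.log_mul (by positivity) (by positivity),
      Real.log_rpow (by positivity), Real.log_mul (by positivity) (by positivity), Real.log_exp,
      Real.log_pow]
  have hneg := EReal.neg_le_neg_iff.mpr hlog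
  refine le_trans (le_of_eq ?_) (mul_le_mul_of_nonneg_left hneg
    (EReal.coe_nonneg.mpr (by positivity : (0 : ℝ) ≤ 1 / n)))
  rw [← EReal.coe_neg, ← EReal.coe_mul]
  congr 1
  field_simp
  ring

end Exponent

end QExp

end

/-! ### Conclusion -/

theorem mainTheorem9 {a b : Type*} [Fintype a] [DecidableEq a] [Fintype b] [DecidableEq b]
    (W : Matrix a a ℂ →ₗ[ℂ] Matrix b b ℂ) (hW : QExp.IsChannel W)
    (r : ℝ) (hr : 0 ≤ r) (α : ℝ) (hα : 0 < α) (hα' : α ≤ 1) :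
    (⨆ (ρ : Matrix a a ℂ) (_ : QExp.IsState ρ), ⨅ (σ : Matrix b b ℂ) (_ : QExp.IsState σ),
      (((1 - α) / α : ℝ) : EReal) *
        (QExp.petzRenyi α (QExp.inputState ρ (QExp.choi W)) (ρ ⊗ₖ σ) - (r : EReal)))
      ≤ QExp.ansExponent W r := by
  refine iSup₂_le fun ρ hρ => ?_
  have hA := QExp.posSemidef_inputState hρ.posSemidef hW.posSemidef_choi
  rcases hα'.eq_or_lt with rfl | hlt
  -- At `α = 1` the prefactor is 0, and `0 * ⊤ = 0` in `EReal`, so any state `σ` would do. Some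
  -- state must be exhibited because an empty infimum is `⊤`; the output marginal is at hand.
  · have hσ : QExp.IsState (QExp.traceLeft (QExp.inputState ρ (QExp.choi W))) := by
      refine ⟨QExp.posSemidef_traceLeft hA, ?_⟩
      have h := QExp.trace_traceLeft_mul (QExp.inputState ρ (QExp.choi W)) 1
      rwa [Matrix.mul_one, one_kronecker_one, Matrix.mul_one,
        QExp.trace_inputState hW.isTracePreservingChoi hρ] at h
    refine (iInf₂_le _ hσ).trans ?_
    simpa using QExp.ansExponent_nonneg hW hρ r
  · rcases (QExp.petzTrace_nonneg α hρ.posSemidef hA).eq_or_lt with h0 | hg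
    · rw [QExp.ansExponent_eq_top hW hρ hα hlt r h0.symm]
      exact le_top
    · obtain ⟨σ, hσ, hval⟩ := QExp.exists_state_petzRenyi_eq hα hlt hρ.posSemidef hA hg
      refine (iInf₂_le σ hσ).trans (le_trans (le_of_eq ?_)
        (QExp.le_ansExponent hW hρ hα hlt hr hg))
      rw [hval, ← EReal.coe_sub, ← EReal.coe_mul]
      congr 1
      have h1 : α - 1 ≠ 0 := by linarith
      field_simp
      ring
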